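/- Boxes are arranged in rows and columns; a diagram is the Ferrers diagram of a partition or a skew diagram $\lambda/\mu$ (possibly disconnected). The length of a column is its number of boxes. The skew Schur function of a diagram $D$ is $s_D=\sum_T x_1^{\#1\text{'s in }T}x_2^{\#2\text{'s in }T}\cdots$, summed over all fillings $T$ of $D$ with positive integers that increase weakly along rows (left to right) and strictly down columns. For a composition $\alpha=(\alpha_1,\dots,\alpha_n)$ (positive integers) let $\delta_\alpha$ be the Ferrers diagram of the partition with exactly $\alpha_i$ parts equal to $i$ for $i=1,\dots,n$; a fat staircase is a diagram $\delta_\alpha$ or its rotation by $180^\circ$ (the empty diagram, from the empty composition, included). A diagram $D$ is a sum of fat staircases if $s_D$ is a linear combination of Schur functions of fat staircases. For $i\ge 0$ and nonempty diagrams $D_1,D_2$ such that the last (rightmost) column of $D_1$ and the first (leftmost) column of $D_2$ both have length at least $i$, the near-concatenation $D_1\odot_i D_2$ is the diagram obtained by placing $D_1$ and $D_2$ so that the top-right box of $D_1$ is one step left and $i-1$ steps up from the bottom-left box of $D_2$ (for $i=0$: one step left and one step down). **Lemma.** Let $D$ be a skew diagram that is not a sum of fat staircases, let $c$ be a column (a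 diagram with a single column of $n\ge1$ boxes) and let $i\ge0$. If $D\odot_i c$ is defined, it is not a sum of fat staircases; and if $c\odot_i D$ is defined, it is not a sum of fat staircases. **Corollary 1.** If a skew diagram $D$ is not a sum of fat staircases and $D'$ is obtained from $D$ by adding any number of columns, that is, by finitely many steps each of which replaces the current diagram $E$ by $E\odot_i c$ or $c\odot_i E$ for some column $c$ and some $i\ge0$ for which this is defined, then $D'$ is not a sum of fat staircases. **Corollary 2.** Let a skew diagram $D$ be a sum of fat staircases, and let $D'$ be the set of boxes that remains when all boxes in some set of columns are removed from $D$. If $D'$ is connected (any two boxes of $D'$ are joined by a path of steps up, down, left or right inside $D'$), then $D'$ is a sum of fat staircases. -/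

import Mathlib

namespace FatStair

/-- A finite array of boxes in the plane. The box `(r, c)` is in row `r` and column `c`;
rows are numbered from top to bottom, columns from left to right. -/
abbrev Diagram := Finset (ℤ × ℤ)

/-- Move every box by the vector `t`. -/
def translate (t : ℤ × ℤ) (D : Diagram) : Diagram := D.image fun b => b + t

/-- The rotation of a diagram by 180 degrees. -/
def rotate (D : Diagram) : Diagram := D.image fun b => -b

/-- The skew diagram `lam / mu`, with the top-left corner of `lam` at the box `(0, 0)`. -/
def skew (lam mu : YoungDiagram) : Diagram :=
  (lam.cells \ mu.cells).image fun b => ((b.1 : ℤ), (b.2 : ℤ))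

/-- `D` is a skew diagram `lam / mu`, placed anywhere in the plane. The case where `mu` is empty
gives the Ferrers diagrams of partitions. -/
def IsSkewDiagram (D : Diagram) : Prop :=
  ∃ lam mu : YoungDiagram, mu ≤ lam ∧ ∃ t : ℤ × ℤ, D = translate t (skew lam mu)

/-- `b` and `b'` are one step up, down, left or right from each other. -/
def Adjacent (b b' : ℤ × ℤ) : Prop := |b.1 - b'.1| + |b.2 - b'.2| = 1

/-- Any two boxes are joined by a path of steps that never leaves the diagram. -/
def IsConnectedDiagram (D : Diagram) : Prop :=
  ∀ b ∈ D, ∀ b' ∈ D,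
    Relation.ReflTransGen (fun x y => x ∈ D ∧ y ∈ D ∧ Adjacent x y) b b'

/-- The boxes of `D` in column `j`. -/
def col (D : Diagram) (j : ℤ) : Diagram := D.filter fun b => b.2 = j

/-- The number of the last (rightmost) column of a nonempty diagram. -/
def lastCol (D : Diagram) : ℤ := (D.image Prod.snd).max.unbotD 0

/-- The number of the first (leftmost) column of a nonempty diagram. -/
def firstCol (D : Diagram) : ℤ := (D.image Prod.snd).min.untopD 0

/-- The top box of the last column of a nonempty diagram. -/
def topRight (D : Diagram) : ℤ × ℤ :=
  (((col D (lastCol D)).image Prod.fst).min.untopD 0, lastCol D)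

/-- The bottom box of the first column of a nonempty diagram. -/
def bottomLeft (D : Diagram) : ℤ × ℤ :=
  (((col D (firstCol D)).image Prod.fst).max.unbotD 0, firstCol D)

/-- The near-concatenation of depth `i` of `D₁` and `D₂` is defined if the last column of `D₁` and
the first column of `D₂` both have length at least `i`. -/
def CanNearConcat (i : ℕ) (D₁ D₂ : Diagram) : Prop :=
  D₁.Nonempty ∧ D₂.Nonempty ∧ i ≤ (col D₁ (lastCol D₁)).card ∧ i ≤ (col D₂ (firstCol D₂)).card

/-- The near-concatenation of depth `i`: `D₂` is moved so that the top-right box of `D₁` is one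
step left and `i - 1` steps up from the bottom-left box of `D₂`. Depth `0` is the direct sum. -/
def nearConcat (i : ℕ) (D₁ D₂ : Diagram) : Diagram :=
  D₁ ∪ translate (topRight D₁ + ((i : ℤ) - 1, 1) - bottomLeft D₂) D₂

/-- The column with `n` boxes. -/
def column (n : ℕ) : Diagram := (Finset.range n).image fun r : ℕ => ((r : ℤ), (0 : ℤ))

/-- `E` is obtained from `D` by the addition of a single column, on the right or on the left. -/
def AddsColumn (D E : Diagram) : Prop :=
  ∃ n i : ℕ, (CanNearConcat i D (column n) ∧ E = nearConcat i D (column n)) ∨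
    (CanNearConcat i (column n) D ∧ E = nearConcat i (column n) D)

/-- Remove from `D` the columns whose numbers belong to `R`. -/
def removeColumns (D : Diagram) (R : Finset ℤ) : Diagram := D.filter fun b => b.2 ∉ R

/-- Semistandard fillings: weakly increasing along rows, strictly increasing down columns. The
letter `k : ℕ` stands for the positive integer `k + 1`. -/
def IsSSYT {D : Diagram} (T : D → ℕ) : Prop :=
  (∀ b b' : D, b.1.1 = b'.1.1 → b.1.2 < b'.1.2 → T b ≤ T b') ∧
    (∀ b b' : D, b.1.2 = b'.1.2 → b.1.1 < b'.1.1 → T b < T b')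

/-- The content of a filling: `content T k` is the number of boxes with letter `k`. -/
noncomputable def content {D : Diagram} (T : D → ℕ) : ℕ →₀ ℕ := ∑ b : D, Finsupp.single (T b) 1

/-- The skew Schur function of `D`, a formal power series in infinitely many variables: the
coefficient of the monomial with exponents `m` is the number of semistandard fillings of `D` with
content `m`. -/
noncomputable def schur (D : Diagram) : MvPowerSeries ℕ ℤ :=
  fun m => (Set.ncard {T : D → ℕ | IsSSYT T ∧ content T = m} : ℤ)

/-- The left-justified diagram whose rows have the given lengths, from top to bottom. -/
def ferrers (w : List ℕ) : Diagram :=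
  (Finset.range w.length).biUnion fun r : ℕ =>
    (Finset.range (w.getD r 0)).image fun c : ℕ => ((r : ℤ), (c : ℤ))

/-- For `α = (α₁, …, αₙ)`, the Ferrers diagram of the partition which has `αᵢ` parts equal to `i`
for each `i`, that is, of `(n ^ αₙ, …, 2 ^ α₂, 1 ^ α₁)`. -/
def stair (α : List ℕ) : Diagram :=
  ferrers (α.mapIdx fun i a => List.replicate a (i + 1)).flatten.reverse

/-- A fat staircase is the diagram above for a composition `α` (a sequence of positive integers),
or the rotation of such a diagram, placed anywhere in the plane. -/
def IsFatStaircase (E : Diagram) : Prop :=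
  ∃ α : List ℕ, (∀ a ∈ α, 0 < a) ∧ ∃ t : ℤ × ℤ,
    E = translate t (stair α) ∨ E = translate t (rotate (stair α))

/-- The skew Schur function of `D` is a linear combination of Schur functions of fat
staircases. -/
def IsSumOfFatStaircases (D : Diagram) : Prop :=
  schur D ∈ Submodule.span ℤ {f | ∃ E, IsFatStaircase E ∧ f = schur E}

/-- The fillings counted by a coefficient of `schur D` are finite in number. -/
theorem finite_fillings (D : Diagram) (m : ℕ →₀ ℕ) :
    {T : D → ℕ | IsSSYT T ∧ content T = m}.Finite := by
  refine (Set.Finite.pi' (t := fun _ : D => (m.support : Set ℕ))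
    fun _ => m.support.finite_toSet).subset ?_
  rintro T ⟨-, rfl⟩ b
  simp only [Finset.mem_coe, Finsupp.mem_support_iff, content, Finsupp.finsetSum_apply]
  intro h
  have := (Finset.sum_eq_zero_iff.mp h) b (Finset.mem_univ b)
  simp at this

/-- Skew diagrams are the finite sets of boxes which are convex for the product order. -/
theorem isSkewDiagram_iff (D : Diagram) :
    IsSkewDiagram D ↔ (D : Set (ℤ × ℤ)).OrdConnected := by
  constructor
  · rintro ⟨lam, mu, -, t, rfl⟩
    refine ⟨?_⟩
    intro x hx y hy z hz
    simp only [translate, skew, Finset.coe_image, Set.mem_image, Finset.mem_coe,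
      Finset.mem_sdiff] at hx hy ⊢
    obtain ⟨_, ⟨a, ⟨_, ha2⟩, rfl⟩, rfl⟩ := hx
    obtain ⟨_, ⟨b, ⟨hb1, _⟩, rfl⟩, rfl⟩ := hy
    obtain ⟨⟨h1, h2⟩, ⟨h3, h4⟩⟩ := hz
    simp only [Prod.fst_add, Prod.snd_add] at h1 h2 h3 h4
    refine ⟨z - t, ⟨((z.1 - t.1).toNat, (z.2 - t.2).toNat), ⟨?_, ?_⟩, ?_⟩, by simp⟩
    · exact lam.isLowerSet (show ((z.1 - t.1).toNat, (z.2 - t.2).toNat) ≤ b from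
        ⟨by simp only; omega, by simp only; omega⟩) hb1
    · intro hc
      exact ha2 (mu.isLowerSet (show a ≤ ((z.1 - t.1).toNat, (z.2 - t.2).toNat) from
        ⟨by simp only; omega, by simp only; omega⟩) hc)
    · ext
      · simp only [Prod.fst_sub]; omega
      · simp only [Prod.snd_sub]; omega
  · intro h
    obtain ⟨p, hp⟩ : ∃ p : ℤ × ℤ, ∀ b ∈ D, p ≤ b := D.bddBelow
    obtain ⟨q, hq⟩ : ∃ q : ℤ × ℤ, ∀ b ∈ D, b ≤ q := D.bddAbove
    classical
    let box : Finset (ℕ × ℕ) :=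
      Finset.range ((q.1 - p.1).toNat + 1) ×ˢ Finset.range ((q.2 - p.2).toNat + 1)
    let f : ℕ × ℕ → ℤ × ℤ := fun b => ((b.1 : ℤ) + p.1, (b.2 : ℤ) + p.2)
    have hf : ∀ {a b : ℕ × ℕ}, a ≤ b → f a ≤ f b := fun {a b} hab =>
      ⟨by have := hab.1; simp only [f]; omega, by have := hab.2; simp only [f]; omega⟩
    have hbox : ∀ {a b : ℕ × ℕ}, a ≤ b → b ∈ box → a ∈ box := by
      intro a b hab hb
      have h1 := hab.1
      have h2 := hab.2
      simp only [box, Finset.mem_product, Finset.mem_range] at hb ⊢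
      omega
    let lam : YoungDiagram := ⟨box.filter fun b => ∃ d ∈ D, f b ≤ d, by
      intro b a hab hb
      simp only [Finset.coe_filter, Set.mem_ofPred_eq] at hb ⊢
      obtain ⟨hb, d, hd, hbd⟩ := hb
      exact ⟨hbox hab hb, d, hd, (hf hab).trans hbd⟩⟩
    let mu : YoungDiagram := ⟨box.filter fun b => (∃ d ∈ D, f b ≤ d) ∧ f b ∉ D, by
      intro b a hab hb
      simp only [Finset.coe_filter, Set.mem_ofPred_eq] at hb ⊢
      obtain ⟨hb, ⟨d, hd, hbd⟩, hn⟩ := hb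
      exact ⟨hbox hab hb, ⟨d, hd, (hf hab).trans hbd⟩,
        fun ha => hn (h.out ha hd ⟨hf hab, hbd⟩)⟩⟩
    refine ⟨lam, mu, ?_, p, ?_⟩
    · intro b hb
      have hb' : b ∈ box.filter fun b => (∃ d ∈ D, f b ≤ d) ∧ f b ∉ D := hb
      show b ∈ box.filter fun b => ∃ d ∈ D, f b ≤ d
      rw [Finset.mem_filter] at hb' ⊢
      exact ⟨hb'.1, hb'.2.1⟩
    · ext d
      simp only [translate, skew, Finset.mem_image, Finset.mem_sdiff, lam, mu, Finset.mem_filter]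
      constructor
      · intro hd
        obtain ⟨h1, h2⟩ := hp d hd
        obtain ⟨h3, h4⟩ := hq d hd
        have hfd : f ((d.1 - p.1).toNat, (d.2 - p.2).toNat) = d := by
          ext
          · simp only [f]; omega
          · simp only [f]; omega
        refine ⟨d - p, ⟨((d.1 - p.1).toNat, (d.2 - p.2).toNat), ⟨⟨?_, d, hd, hfd.le⟩, ?_⟩, ?_⟩,
          by simp⟩
        · simp only [box, Finset.mem_product, Finset.mem_range]
          omega
        · rw [hfd]
          exact fun hc => hc.2.2 hd
        · ext
          · simp only [Prod.fst_sub]; omega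
          · simp only [Prod.snd_sub]; omega
      · rintro ⟨_, ⟨b, ⟨⟨hb, hex⟩, hn⟩, rfl⟩, rfl⟩
        by_contra hd
        exact hn ⟨hb, hex, hd⟩

end FatStair

open FatStair

namespace FatStair

/-! The Schur function of a fat staircase, rotated or not, is `s_λ` for a partition `λ` whose
consecutive parts, trailing zeros included, differ by at most 1, and every such `λ` occurs
(`IsFatStaircase.exists_shape`, `exists_stair`). By the Littlewood–Richardson rule the coefficient
of `s_λ` in `s_D` counts the Littlewood–Richardson fillings of `D` with content `λ`. Hence `D` is a
sum of fat staircases exactly when no such filling has a content that drops by 2 or more from one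
letter to the next (`content_le_of_isSum`, `isSum_of_content_le`).

This property passes to what is left after deleting all columns left of a column `p`. Given a
Littlewood–Richardson filling of the remaining columns, fill each deleted column with `0, 1, 2, …`
from the top. The result is again a Littlewood–Richardson filling (`isSSYT_extendFilling`,
`isLR_extendFilling`), and each restored column has at least as many letters `k` as `k + 1`, so a
drop of 2 or more survives. Rotation by 180° preserves `s_D` and gives the same for columns on the
right. The three claims follow: `D` is a final or initial run of columns of a near-concatenation,
and a connected remainder occupies consecutive columns.

The Littlewood–Richardson rule rests on the functional `schurCoeff`, which on symmetric functions is
the coefficient of `x^(λ+δ)` in `a_δ f`, where `δ = (N-1, …, 1, 0)`. A Bender–Knuth involution left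
of the first violation cancels every filling that is not Littlewood–Richardson
(`sum_alternant_not_isLR`). Such coefficients determine a symmetric function
(`eq_zero_of_schurCoeff`). -/

/-! ### The Bender–Knuth involution on the columns left of a given one -/

/-- A finite set of integers has an order-reversing involution. -/
theorem exists_rev (F : Finset ℤ) : ∃ σ : ℤ → ℤ, (∀ c ∈ F, σ c ∈ F) ∧ (∀ c ∈ F, σ (σ c) = c) ∧
    ∀ c ∈ F, ∀ c' ∈ F, c ≤ c' → σ c' ≤ σ c := by
  classical
  let e := F.orderIsoOfFin rfl
  let σ : ℤ → ℤ := fun c => if h : c ∈ F then e (Fin.rev (e.symm ⟨c, h⟩)) else c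
  have hσ : ∀ c (h : c ∈ F), σ c = e (Fin.rev (e.symm ⟨c, h⟩)) := fun c h => dif_pos h
  have hm : ∀ c ∈ F, σ c ∈ F := fun c h => by rw [hσ c h]; exact Subtype.coe_prop _
  refine ⟨σ, hm, fun c h => ?_, fun c h c' h' hcc => ?_⟩
  · rw [hσ _ (hm c h)]
    have : (⟨σ c, hm c h⟩ : F) = e (Fin.rev (e.symm ⟨c, h⟩)) := Subtype.ext (hσ c h)
    rw [this]
    simp
  · rw [hσ c h, hσ c' h']
    simpa using hcc

/-- Exchanging two letters reverses the order within a row; reversing the positions as well restores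
it. The reversals of the separate rows are glued together, and the values outside `F` are
irrelevant. -/
theorem exists_mirror {D : Diagram} (F : Finset D) : ∃ σ : D → D, (∀ b ∈ F, σ b ∈ F) ∧
    (∀ b ∈ F, σ (σ b) = b) ∧ (∀ b ∈ F, (σ b).1.1 = b.1.1) ∧
    ∀ b ∈ F, ∀ b' ∈ F, b.1.1 = b'.1.1 → b.1.2 ≤ b'.1.2 → (σ b').1.2 ≤ (σ b).1.2 := by
  classical
  choose ρ hρ using fun r : ℤ => exists_rev ((F.filter fun b => b.1.1 = r).image fun b => b.1.2)
  have key : ∀ b : D, ∃ b' : D, b ∈ F → b' ∈ F ∧ b'.1.1 = b.1.1 ∧ b'.1.2 = ρ b.1.1 b.1.2 := by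
    intro b
    by_cases hb : b ∈ F
    · have := (hρ b.1.1).1 b.1.2 (Finset.mem_image.2 ⟨b, by simp [hb], rfl⟩)
      obtain ⟨b', hb', h⟩ := Finset.mem_image.1 this
      rw [Finset.mem_filter] at hb'
      exact ⟨b', fun _ => ⟨hb'.1, hb'.2, h⟩⟩
    · exact ⟨b, fun h => absurd h hb⟩
  choose σ hσ using key
  have hmem : ∀ b ∈ F, b.1.2 ∈ (F.filter fun x => x.1.1 = b.1.1).image fun x => x.1.2 :=
    fun b hb => Finset.mem_image.2 ⟨b, by simp [hb], rfl⟩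
  refine ⟨σ, fun b hb => (hσ b hb).1, fun b hb => ?_, fun b hb => (hσ b hb).2.1,
    fun b hb b' hb' hr hc => ?_⟩
  · obtain ⟨h1, h2, h3⟩ := hσ b hb
    obtain ⟨h4, h5, h6⟩ := hσ _ h1
    refine Subtype.ext (Prod.ext (h5.trans h2) ?_)
    rw [h6, h2, h3, (hρ b.1.1).2.1 _ (hmem b hb)]
  · rw [(hσ b hb).2.2, (hσ b' hb').2.2, ← hr]
    exact (hρ b.1.1).2.2 _ (hmem b hb) _ (hr ▸ hmem b' hb') hc

/-- An involution of the boxes in `F` which reverses each row of `F`. -/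
noncomputable def mirror {D : Diagram} (F : Finset D) : D → D := (exists_mirror F).choose

section mirror
variable {D : Diagram} {F : Finset D} {b b' : D}

theorem mirror_mem (h : b ∈ F) : mirror F b ∈ F := (exists_mirror F).choose_spec.1 b h
theorem mirror_mirror (h : b ∈ F) : mirror F (mirror F b) = b :=
  (exists_mirror F).choose_spec.2.1 b h
theorem mirror_row (h : b ∈ F) : (mirror F b).1.1 = b.1.1 := (exists_mirror F).choose_spec.2.2.1 b h
theorem mirror_anti (h : b ∈ F) (h' : b' ∈ F) (hr : b.1.1 = b'.1.1) (hc : b.1.2 ≤ b'.1.2) :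
    (mirror F b').1.2 ≤ (mirror F b).1.2 := (exists_mirror F).choose_spec.2.2.2 b h b' h' hr hc

end mirror

/-- The box `b` lies left of column `j` and contains the letter `k` or `k + 1`. -/
def Active {D : Diagram} (T : D → ℕ) (j : ℤ) (k : ℕ) (b : D) : Prop :=
  b.1.2 < j ∧ (T b = k ∨ T b = k + 1)

open Classical in
/-- The active boxes which are the only active ones in their column. -/
noncomputable def freeBoxes {D : Diagram} (T : D → ℕ) (j : ℤ) (k : ℕ) : Finset D :=
  Finset.univ.filter fun b => Active T j k b ∧ ∀ b', Active T j k b' → b'.1.2 = b.1.2 → b' = b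

open Classical in
/-- The Bender–Knuth involution for the letters `k` and `k + 1`, applied to the boxes left of
column `j`. -/
noncomputable def benderKnuth {D : Diagram} (T : D → ℕ) (j : ℤ) (k : ℕ) (b : D) : ℕ :=
  if b ∈ freeBoxes T j k then 2 * k + 1 - T (mirror (freeBoxes T j k) b) else T b

section benderKnuth
variable {D : Diagram} {T : D → ℕ} {j : ℤ} {k : ℕ}

theorem mem_freeBoxes {b : D} : b ∈ freeBoxes T j k ↔
    Active T j k b ∧ ∀ b', Active T j k b' → b'.1.2 = b.1.2 → b' = b := by
  simp [freeBoxes]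

theorem benderKnuth_of_mem {b : D} (h : b ∈ freeBoxes T j k) :
    benderKnuth T j k b = 2 * k + 1 - T (mirror (freeBoxes T j k) b) := if_pos h

theorem benderKnuth_of_notMem {b : D} (h : b ∉ freeBoxes T j k) :
    benderKnuth T j k b = T b := if_neg h

theorem benderKnuth_of_not_active {b : D} (h : ¬ Active T j k b) : benderKnuth T j k b = T b :=
  benderKnuth_of_notMem fun hb => h (mem_freeBoxes.1 hb).1

theorem benderKnuth_of_le {b : D} (h : j ≤ b.1.2) : benderKnuth T j k b = T b :=
  benderKnuth_of_not_active fun hb => absurd hb.1 (not_lt.2 h)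

theorem benderKnuth_mem_pair {b : D} (h : Active T j k b) :
    benderKnuth T j k b = k ∨ benderKnuth T j k b = k + 1 := by
  by_cases hb : b ∈ freeBoxes T j k
  · rw [benderKnuth_of_mem hb]
    have := (mem_freeBoxes.1 (mirror_mem hb)).1.2
    omega
  · rw [benderKnuth_of_notMem hb]
    exact h.2

theorem active_benderKnuth {b : D} : Active (benderKnuth T j k) j k b ↔ Active T j k b := by
  constructor
  · intro h
    by_contra hb
    rw [Active, benderKnuth_of_not_active hb] at h
    exact hb h
  · exact fun h => ⟨h.1, benderKnuth_mem_pair h⟩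

theorem freeBoxes_benderKnuth : freeBoxes (benderKnuth T j k) j k = freeBoxes T j k := by
  ext b
  simp only [mem_freeBoxes, active_benderKnuth]

/-- The involution keeps the set of active boxes, hence the set of free ones, so the second
application uses the same mirror and the complement `2 * k + 1 - ·` cancels. -/
theorem benderKnuth_benderKnuth : benderKnuth (benderKnuth T j k) j k = T := by
  funext b
  by_cases hb : b ∈ freeBoxes T j k
  · rw [benderKnuth_of_mem (by rwa [freeBoxes_benderKnuth]), freeBoxes_benderKnuth,
      benderKnuth_of_mem (mirror_mem hb), mirror_mirror hb]
    have := (mem_freeBoxes.1 hb).1.2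
    omega
  · rw [benderKnuth_of_notMem (by rwa [freeBoxes_benderKnuth]), benderKnuth_of_notMem hb]

theorem mem_of_between (hD : (D : Set (ℤ × ℤ)).OrdConnected) {x y : ℤ × ℤ} (hx : x ∈ D) (hy : y ∈ D)
    {r c : ℤ} (h1 : x.1 ≤ r) (h2 : r ≤ y.1) (h3 : x.2 ≤ c) (h4 : c ≤ y.2) : (r, c) ∈ D :=
  hD.out hx hy ⟨⟨h1, h3⟩, ⟨h2, h4⟩⟩

/-- Only letters `k` and `k + 1` change, so rows can fail only between two active boxes or across
the border at column `j`. Across the border, convexity puts a box of column `j` in the same row, and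
since its letter is not `k` there is room for `k + 1`. Columns are safe because two active boxes in
one column are both fixed. -/
theorem isSSYT_benderKnuth (hD : (D : Set (ℤ × ℤ)).OrdConnected) (hT : IsSSYT T)
    (hj : ∀ b : D, b.1.2 = j → T b ≠ k) : IsSSYT (benderKnuth T j k) := by
  obtain ⟨hrow, hcol⟩ := hT
  have hrow' : ∀ b b' : D, b.1.1 = b'.1.1 → b.1.2 ≤ b'.1.2 → T b ≤ T b' := by
    intro b b' h1 h2
    rcases h2.lt_or_eq with h | h
    · exact hrow b b' h1 h
    · exact (congrArg T (Subtype.ext (Prod.ext h1 h))).le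
  refine ⟨fun b b' h1 h2 => ?_, fun b b' h1 h2 => ?_⟩
  · have hbb := hrow b b' h1 h2
    by_cases ha : Active T j k b
    · have hp := benderKnuth_mem_pair ha
      by_cases ha' : Active T j k b'
      · have hp' := benderKnuth_mem_pair ha'
        by_cases hf : b ∈ freeBoxes T j k
        · by_cases hf' : b' ∈ freeBoxes T j k
          · rw [benderKnuth_of_mem hf, benderKnuth_of_mem hf']
            have h3 := mirror_anti hf hf' h1 h2.le
            have h4 := hrow' (mirror (freeBoxes T j k) b') (mirror (freeBoxes T j k) b)
              (by rw [mirror_row hf, mirror_row hf', h1]) h3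
            omega
          · rw [benderKnuth_of_notMem hf']
            by_contra hlt
            have hk : T b' = k := by have := ha'.2; omega
            apply hf'
            rw [mem_freeBoxes]
            refine ⟨ha', fun x hx hxc => ?_⟩
            by_contra hne
            have hxr : b'.1.1 < x.1.1 := by
              rcases lt_trichotomy x.1.1 b'.1.1 with h | h | h
              · have := hcol x b' hxc h
                have := hx.2
                omega
              · exact absurd (Subtype.ext (Prod.ext h hxc)) hne
              · exact h
            -- The partner `x` of `b'` lies below it and contains `k + 1`. The box of its row in the
            -- column of `b` is then squeezed to the letter `k + 1`, so `b` is not free.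
            have hy : (x.1.1, b.1.2) ∈ D := mem_of_between hD b.2 x.2 (by omega) le_rfl le_rfl
              (by omega)
            have h5 := hcol b ⟨_, hy⟩ rfl (by simp only; omega)
            have h6 := hrow' ⟨_, hy⟩ x rfl (by simp only; omega)
            have h7 := (mem_freeBoxes.1 hf).2 ⟨_, hy⟩ ⟨ha.1, by
              have := hx.2; have := ha.2; omega⟩ rfl
            have := congrArg (fun z : D => z.1.1) h7
            simp only at this
            omega
        · rw [benderKnuth_of_notMem hf]
          by_contra hlt
          have hk : T b = k + 1 := by have := ha.2; omega
          have hk' : T b' = k + 1 := by have := ha'.2; omega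
          have hf' : b' ∈ freeBoxes T j k := by
            by_contra hf'
            rw [benderKnuth_of_notMem hf'] at hlt
            omega
          apply hf
          rw [mem_freeBoxes]
          refine ⟨ha, fun x hx hxc => ?_⟩
          by_contra hne
          have hxr : x.1.1 < b.1.1 := by
            rcases lt_trichotomy x.1.1 b.1.1 with h | h | h
            · exact h
            · exact absurd (Subtype.ext (Prod.ext h hxc)) hne
            · have := hcol b x hxc.symm h
              have := hx.2
              omega
          -- The mirror image of the previous argument: the partner `x` lies above `b` and forces a
          -- letter `k` above `b'`.
          have hy : (x.1.1, b'.1.2) ∈ D := mem_of_between hD x.2 b'.2 le_rfl (by omega) (by omega)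
            le_rfl
          have h5 := hcol ⟨_, hy⟩ b' rfl (by simp only; omega)
          have h6 := hrow' x ⟨_, hy⟩ rfl (by simp only; omega)
          have h7 := (mem_freeBoxes.1 hf').2 ⟨_, hy⟩ ⟨ha'.1, by
            have := hx.2; omega⟩ rfl
          have := congrArg (fun z : D => z.1.1) h7
          simp only at this
          omega
      · rw [benderKnuth_of_not_active ha']
        by_cases hc : b'.1.2 < j
        · have : ¬ (T b' = k ∨ T b' = k + 1) := fun h => ha' ⟨hc, h⟩
          have := ha.2
          omega
        · have hy : (b.1.1, j) ∈ D := mem_of_between hD b.2 b'.2 le_rfl h1.le ha.1.le (by omega)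
          have h3 := hrow b ⟨_, hy⟩ rfl ha.1
          have h4 := hrow' ⟨_, hy⟩ b' h1 (by simp only; omega)
          have h5 := hj ⟨_, hy⟩ rfl
          have := ha.2
          omega
    · rw [benderKnuth_of_not_active ha]
      by_cases ha' : Active T j k b'
      · have hp' := benderKnuth_mem_pair ha'
        have : ¬ (T b = k ∨ T b = k + 1) := fun h => ha ⟨h2.trans ha'.1, h⟩
        have := ha'.2
        omega
      · rwa [benderKnuth_of_not_active ha']
  · have hbb := hcol b b' h1 h2
    by_cases ha : Active T j k b
    · have hp := benderKnuth_mem_pair ha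
      by_cases ha' : Active T j k b'
      · have hne : b ≠ b' := by rintro rfl; exact lt_irrefl _ h2
        rw [benderKnuth_of_notMem fun h => hne.symm ((mem_freeBoxes.1 h).2 b' ha' h1.symm),
          benderKnuth_of_notMem fun h => hne ((mem_freeBoxes.1 h).2 b ha h1)]
        exact hbb
      · rw [benderKnuth_of_not_active ha']
        have : ¬ (T b' = k ∨ T b' = k + 1) := fun h => ha' ⟨h1 ▸ ha.1, h⟩
        have := ha.2
        omega
    · rw [benderKnuth_of_not_active ha]
      by_cases ha' : Active T j k b'
      · have hp' := benderKnuth_mem_pair ha'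
        have : ¬ (T b = k ∨ T b = k + 1) := fun h => ha ⟨h1 ▸ ha'.1, h⟩
        have := ha'.2
        omega
      · rwa [benderKnuth_of_not_active ha']

/-- The number of boxes left of column `j` with the letter `k`. -/
def countLeft (T : D → ℕ) (j : ℤ) (k : ℕ) : ℕ :=
  (Finset.univ.filter fun b : D => b.1.2 < j ∧ T b = k).card

/-- The number of boxes in column `j` or to the right of it with the letter `k`. -/
def countRight (T : D → ℕ) (j : ℤ) (k : ℕ) : ℕ :=
  (Finset.univ.filter fun b : D => j ≤ b.1.2 ∧ T b = k).card

theorem content_apply (T : D → ℕ) (k : ℕ) :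
    content T k = (Finset.univ.filter fun b : D => T b = k).card := by
  simp only [content, Finsupp.finsetSum_apply, Finsupp.single_apply, Finset.card_filter]

theorem content_eq_add (T : D → ℕ) (j : ℤ) (k : ℕ) :
    content T k = countLeft T j k + countRight T j k := by
  classical
  rw [content_apply, countLeft, countRight, ← Finset.card_union_of_disjoint]
  · congr 1
    ext b
    simp only [Finset.mem_filter, Finset.mem_univ, true_and, Finset.mem_union]
    have := lt_or_ge b.1.2 j
    tauto
  · rw [Finset.disjoint_left]
    intro b h h'
    simp only [Finset.mem_filter] at h h'
    omega

theorem countRight_benderKnuth (l : ℕ) :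
    countRight (benderKnuth T j k) j l = countRight T j l := by
  rw [countRight, countRight]
  congr 1
  ext b
  simp only [Finset.mem_filter, Finset.mem_univ, true_and]
  refine and_congr_right fun h => ?_
  rw [benderKnuth_of_le h]

theorem countLeft_benderKnuth_of_ne {l : ℕ} (h1 : l ≠ k) (h2 : l ≠ k + 1) :
    countLeft (benderKnuth T j k) j l = countLeft T j l := by
  rw [countLeft, countLeft]
  congr 1
  ext b
  simp only [Finset.mem_filter, Finset.mem_univ, true_and]
  refine and_congr_right fun h => ?_
  by_cases ha : Active T j k b
  · have := benderKnuth_mem_pair ha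
    have := ha.2
    constructor <;> intro <;> omega
  · rw [benderKnuth_of_not_active ha]

/-- Active boxes that are not free come in pairs `k`, `k + 1` in a column, so both sets project
injectively to the same set of columns. -/
theorem card_matched_eq (hT : IsSSYT T) :
    (Finset.univ.filter fun b : D => (b.1.2 < j ∧ T b = k) ∧ b ∉ freeBoxes T j k).card =
    (Finset.univ.filter fun b : D => (b.1.2 < j ∧ T b = k + 1) ∧ b ∉ freeBoxes T j k).card := by
  classical
  have inj : ∀ l, Set.InjOn (fun b : D => b.1.2)
      (Finset.univ.filter fun b : D => (b.1.2 < j ∧ T b = l) ∧ b ∉ freeBoxes T j k) := by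
    intro l b hb b' hb' h
    simp only [Finset.coe_filter, Finset.mem_univ, true_and, Set.mem_ofPred_eq] at hb hb' h
    rcases lt_trichotomy b.1.1 b'.1.1 with h1 | h1 | h1
    · have := hT.2 b b' h h1
      omega
    · exact Subtype.ext (Prod.ext h1 h)
    · have := hT.2 b' b h.symm h1
      omega
  rw [← Finset.card_image_of_injOn (inj k), ← Finset.card_image_of_injOn (inj (k + 1))]
  congr 1
  have key : ∀ b : D, Active T j k b → b ∉ freeBoxes T j k →
      ∃ b' : D, b'.1.2 = b.1.2 ∧ Active T j k b' ∧ b' ∉ freeBoxes T j k ∧ T b' ≠ T b := by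
    intro b ha hb
    rw [mem_freeBoxes] at hb
    push Not at hb
    obtain ⟨b', h1, h2, h3⟩ := hb ha
    refine ⟨b', h2, h1, fun h => h3.symm ((mem_freeBoxes.1 h).2 b ha h2.symm), fun h => ?_⟩
    rcases lt_trichotomy b.1.1 b'.1.1 with h4 | h4 | h4
    · have := hT.2 b b' h2.symm h4
      omega
    · exact h3 (Subtype.ext (Prod.ext h4.symm h2))
    · have := hT.2 b' b h2 h4
      omega
  ext c
  simp only [Finset.mem_image, Finset.mem_filter, Finset.mem_univ, true_and]
  constructor
  · rintro ⟨b, ⟨⟨h1, h2⟩, h3⟩, rfl⟩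
    obtain ⟨b', h4, h5, h6, h7⟩ := key b ⟨h1, Or.inl h2⟩ h3
    exact ⟨b', ⟨⟨h5.1, by have := h5.2; omega⟩, h6⟩, h4⟩
  · rintro ⟨b, ⟨⟨h1, h2⟩, h3⟩, rfl⟩
    obtain ⟨b', h4, h5, h6, h7⟩ := key b ⟨h1, Or.inr h2⟩ h3
    exact ⟨b', ⟨⟨h5.1, by have := h5.2; omega⟩, h6⟩, h4⟩

/-- The mirror matches the free boxes whose new letter is `k` with the free boxes whose old letter
is `k + 1`; the other boxes are balanced by `card_matched_eq`. -/
theorem countLeft_benderKnuth (hT : IsSSYT T) :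
    countLeft (benderKnuth T j k) j k = countLeft T j (k + 1) := by
  classical
  rw [countLeft, countLeft, ← Finset.card_filter_add_card_filter_not (· ∈ freeBoxes T j k),
    ← Finset.card_filter_add_card_filter_not
      (s := Finset.univ.filter fun b : D => b.1.2 < j ∧ T b = k + 1) (· ∈ freeBoxes T j k)]
  simp only [Finset.filter_filter]
  congr 1
  · refine Finset.card_bij' (fun b _ => mirror (freeBoxes T j k) b)
      (fun b _ => mirror (freeBoxes T j k) b) ?_ ?_ ?_ ?_
    · intro b hb
      simp only [Finset.mem_filter, Finset.mem_univ, true_and] at hb ⊢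
      obtain ⟨⟨h1, h2⟩, h3⟩ := hb
      rw [benderKnuth_of_mem h3] at h2
      have := mirror_mem h3
      have h4 := (mem_freeBoxes.1 this).1
      exact ⟨⟨h4.1, by have := h4.2; omega⟩, this⟩
    · intro b hb
      simp only [Finset.mem_filter, Finset.mem_univ, true_and] at hb ⊢
      obtain ⟨⟨h1, h2⟩, h3⟩ := hb
      have := mirror_mem h3
      rw [benderKnuth_of_mem this, mirror_mirror h3]
      exact ⟨⟨(mem_freeBoxes.1 this).1.1, by omega⟩, this⟩
    · intro b hb
      simp only [Finset.mem_filter] at hb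
      exact mirror_mirror hb.2.2
    · intro b hb
      simp only [Finset.mem_filter] at hb
      exact mirror_mirror hb.2.2
  · rw [← card_matched_eq hT]
    congr 1
    ext b
    simp only [Finset.mem_filter, Finset.mem_univ, true_and]
    refine and_congr_left fun h => ?_
    rw [benderKnuth_of_notMem h]

theorem countLeft_benderKnuth_succ (hT : IsSSYT (benderKnuth T j k)) :
    countLeft (benderKnuth T j k) j (k + 1) = countLeft T j k := by
  rw [← countLeft_benderKnuth hT, benderKnuth_benderKnuth]

end benderKnuth

/-! ### Symmetry of skew Schur functions; invariance under translation and rotation -/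

/-- The number of semistandard fillings of `D` with `a k` letters `k` for each `k`. -/
noncomputable def fillCount (D : Diagram) (a : ℕ → ℕ) : ℕ :=
  Set.ncard {T : D → ℕ | IsSSYT T ∧ ⇑(content T) = a}

theorem schur_apply (D : Diagram) (m : ℕ →₀ ℕ) : schur D m = fillCount D m := by
  simp only [schur, fillCount, DFunLike.coe_fn_eq]

theorem content_comp {D E : Diagram} (e : E ≃ D) (ρ : Equiv.Perm ℕ) (T : D → ℕ) :
    ⇑(content (ρ ∘ T ∘ e)) = content T ∘ ρ.symm := by
  funext k
  rw [Function.comp_apply, content_apply, content_apply]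
  refine Finset.card_bij (fun b _ => e b) ?_ (fun _ _ _ _ h => e.injective h) ?_
  · intro b hb
    simp only [Finset.mem_filter, Finset.mem_univ, true_and, Function.comp_apply] at hb ⊢
    rw [← hb, ρ.symm_apply_apply]
  · intro b hb
    simp only [Finset.mem_filter, Finset.mem_univ, true_and, Function.comp_apply] at hb ⊢
    exact ⟨e.symm b, by simp [hb], by simp⟩

theorem fillCount_congr {D E : Diagram} (e : E ≃ D) (ρ : Equiv.Perm ℕ) (a : ℕ → ℕ)
    (h : ∀ T : D → ℕ, ⇑(content T) = a → IsSSYT T → IsSSYT (ρ ∘ T ∘ e))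
    (h' : ∀ T : E → ℕ, ⇑(content T) = a ∘ ρ.symm → IsSSYT T → IsSSYT (ρ.symm ∘ T ∘ e.symm)) :
    fillCount E (a ∘ ρ.symm) = fillCount D a := by
  symm
  refine Set.ncard_congr (fun T _ => ρ ∘ T ∘ e) ?_ ?_ ?_
  · rintro T ⟨h1, h2⟩
    exact ⟨h T h2 h1, by rw [content_comp, h2]⟩
  · intro T T' _ _ hTT
    funext b
    have := congrFun hTT (e.symm b)
    simpa using this
  · rintro T ⟨h1, h2⟩
    refine ⟨ρ.symm ∘ T ∘ e.symm, ⟨h' T h2 h1, ?_⟩, ?_⟩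
    · rw [content_comp, h2]
      funext k
      simp
    · funext b
      simp

/-- The boxes of a translated diagram. -/
def translateEquiv (t : ℤ × ℤ) (D : Diagram) : translate t D ≃ D where
  toFun b := ⟨b.1 - t, by
    obtain ⟨x, hx, h⟩ := Finset.mem_image.1 b.2
    rw [← h, add_sub_cancel_right]
    exact hx⟩
  invFun b := ⟨b.1 + t, Finset.mem_image_of_mem _ b.2⟩
  left_inv b := by simp
  right_inv b := by simp

/-- The boxes of a rotated diagram. -/
def rotateEquiv (D : Diagram) : rotate D ≃ D where
  toFun b := ⟨-b.1, by
    obtain ⟨x, hx, h⟩ := Finset.mem_image.1 b.2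
    rw [← h, neg_neg]
    exact hx⟩
  invFun b := ⟨-b.1, Finset.mem_image_of_mem _ b.2⟩
  left_inv b := by simp
  right_inv b := by simp

theorem schur_translate (t : ℤ × ℤ) (D : Diagram) : schur (translate t D) = schur D := by
  funext m
  rw [schur_apply, schur_apply]
  refine congrArg _ (fillCount_congr (translateEquiv t D) 1 m (fun T _ hT => ?_) fun T _ hT => ?_)
  · exact ⟨fun b b' h1 h2 => hT.1 _ _ (by simpa [translateEquiv] using h1)
      (by simpa [translateEquiv] using h2), fun b b' h1 h2 => hT.2 _ _
      (by simpa [translateEquiv] using h1) (by simpa [translateEquiv] using h2)⟩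
  · exact ⟨fun b b' h1 h2 => hT.1 _ _ (by simpa [translateEquiv] using h1)
      (by simpa [translateEquiv] using h2), fun b b' h1 h2 => hT.2 _ _
      (by simpa [translateEquiv] using h1) (by simpa [translateEquiv] using h2)⟩

theorem exists_col_bound (D : Diagram) : ∃ j : ℤ, ∀ b : D, b.1.2 < j := by
  obtain ⟨q, hq⟩ : ∃ q : ℤ × ℤ, ∀ b ∈ D, b ≤ q := D.bddAbove
  exact ⟨q.2 + 1, fun b => by have := (hq b.1 b.2).2; omega⟩

theorem countRight_eq_zero {D : Diagram} {j : ℤ} (h : ∀ b : D, b.1.2 < j) (T : D → ℕ) (k : ℕ) :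
    countRight T j k = 0 := by
  rw [countRight, Finset.card_eq_zero, Finset.filter_eq_empty_iff]
  intro b _ hb
  have := h b
  omega

/-- The Bender–Knuth involution is applied to the whole diagram: `j` is chosen to the right of all
boxes, so column `j` is empty and imposes no condition. -/
theorem fillCount_swap {D : Diagram} (hD : (D : Set (ℤ × ℤ)).OrdConnected) (k : ℕ) (a : ℕ → ℕ) :
    fillCount D (a ∘ Equiv.swap k (k + 1)) = fillCount D a := by
  obtain ⟨j, hj⟩ := exists_col_bound D
  have hno : ∀ (T : D → ℕ) (b : D), b.1.2 = j → T b ≠ k := fun T b hb => absurd hb (hj b).ne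
  have hcontent : ∀ T : D → ℕ, IsSSYT T →
      ⇑(content (benderKnuth T j k)) = content T ∘ Equiv.swap k (k + 1) := by
    intro T hT
    funext l
    have hc := fun (T : D → ℕ) l => (content_eq_add T j l).trans
      (by rw [countRight_eq_zero hj, add_zero])
    rw [Function.comp_apply, hc, hc]
    rcases eq_or_ne l k with rfl | h1
    · rw [Equiv.swap_apply_left, countLeft_benderKnuth hT]
    · rcases eq_or_ne l (k + 1) with rfl | h2
      · rw [Equiv.swap_apply_right,
          countLeft_benderKnuth_succ (isSSYT_benderKnuth hD hT (hno T))]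
      · rw [Equiv.swap_apply_of_ne_of_ne h1 h2, countLeft_benderKnuth_of_ne h1 h2]
  symm
  refine Set.ncard_congr (fun T _ => benderKnuth T j k) ?_ ?_ ?_
  · rintro T ⟨h1, h2⟩
    exact ⟨isSSYT_benderKnuth hD h1 (hno T), by rw [hcontent T h1, h2]⟩
  · intro T T' _ _ h
    rw [← benderKnuth_benderKnuth (T := T), h, benderKnuth_benderKnuth]
  · rintro T ⟨h1, h2⟩
    refine ⟨benderKnuth T j k, ⟨isSSYT_benderKnuth hD h1 (hno T), ?_⟩, benderKnuth_benderKnuth⟩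
    rw [hcontent T h1, h2]
    funext l
    simp

/-- The finitary permutations of the letters which preserve the number of fillings. -/
noncomputable def fillSymm (D : Diagram) : Submonoid (Equiv.Perm ℕ) where
  carrier := {π | ∀ a, fillCount D (a ∘ π) = fillCount D a}
  mul_mem' {π _} hπ hσ a := (hσ (a ∘ π)).trans (hπ a)
  one_mem' _ := rfl

theorem fillCount_perm {D : Diagram} (hD : (D : Set (ℤ × ℤ)).OrdConnected) (n : ℕ)
    (π : Equiv.Perm (Fin (n + 1))) (a : ℕ → ℕ) :
    fillCount D (a ∘ π.extendDomain Fin.equivSubtype) = fillCount D a := by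
  have h : Submonoid.closure (Set.range fun i : Fin n => Equiv.swap i.castSucc i.succ) ≤
      (fillSymm D).comap (Equiv.Perm.extendDomainHom (Fin.equivSubtype (n := n + 1))) := by
    rw [Submonoid.closure_le]
    rintro _ ⟨i, rfl⟩
    have : (Equiv.swap i.castSucc i.succ).extendDomain (Fin.equivSubtype (n := n + 1)) =
        Equiv.swap (i : ℕ) (i + 1) := by
      ext l
      by_cases hl : l < n + 1
      · rw [Equiv.Perm.extendDomain_apply_subtype (p := fun l => l < n + 1) _ _ hl]
        rcases eq_or_ne l i with rfl | h1
        · rw [Equiv.swap_apply_left, show (Fin.equivSubtype (n := n + 1)).symm ⟨i, hl⟩ =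
            i.castSucc from rfl, Equiv.swap_apply_left]
          rfl
        · rcases eq_or_ne l (i + 1) with rfl | h2
          · rw [Equiv.swap_apply_right, show (Fin.equivSubtype (n := n + 1)).symm ⟨i + 1, hl⟩ =
              i.succ from rfl, Equiv.swap_apply_right]
            rfl
          · rw [Equiv.swap_apply_of_ne_of_ne h1 h2, Equiv.swap_apply_of_ne_of_ne]
            · simp
            · intro h; exact h1 (by simpa using congrArg Fin.val h)
            · intro h; exact h2 (by simpa using congrArg Fin.val h)
      · rw [Equiv.Perm.extendDomain_apply_not_subtype (p := fun l => l < n + 1) _ _ hl,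
          Equiv.swap_apply_of_ne_of_ne]
        · omega
        · omega
    show ∀ a, _
    intro a
    rw [Equiv.Perm.extendDomainHom_apply, this]
    exact fillCount_swap hD i a
  rw [Equiv.Perm.mclosure_swap_castSucc_succ] at h
  exact h (Submonoid.mem_top π) a

/-- Rotating a filling and reversing the order of its letters keeps it semistandard and reverses its
content; symmetry in the letters then undoes the reversal. -/
theorem schur_rotate {D : Diagram} (hD : (D : Set (ℤ × ℤ)).OrdConnected) :
    schur (rotate D) = schur D := by
  funext m
  rw [schur_apply, schur_apply]
  obtain ⟨n, hn⟩ : ∃ n, ∀ i, n < i → m i = 0 := by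
    obtain ⟨n, hn⟩ := m.support.bddAbove
    refine ⟨n, fun i hi => ?_⟩
    by_contra h
    exact absurd (hn (Finsupp.mem_support_iff.2 h)) (not_le.2 hi)
  -- The reversal of `0, …, n`, where `n` bounds the letters in use; larger letters are fixed.
  set ρ : Equiv.Perm ℕ :=
    (Fin.revPerm (n := n + 1)).extendDomain Fin.equivSubtype with hρ
  have hval : ∀ i, i ≤ n → ρ i = n - i := by
    intro i hi
    rw [hρ, Equiv.Perm.extendDomain_apply_subtype (p := fun l => l < n + 1) _ _
      (show i < n + 1 by omega)]
    simp
  have hval' : ∀ i, n < i → ρ i = i := fun i hi =>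
    Equiv.Perm.extendDomain_apply_not_subtype (p := fun l => l < n + 1) _ _ (by omega)
  have hsymm : ρ.symm = ρ := by
    ext i
    rw [Equiv.symm_apply_eq]
    rcases le_or_gt i n with hi | hi
    · rw [hval i hi, hval _ (Nat.sub_le n i)]
      omega
    · rw [hval' i hi, hval' i hi]
  have hle : ∀ {E : Diagram} (T : E → ℕ), (∀ i, n < i → content T i = 0) → ∀ b, T b ≤ n := by
    intro E T hT b
    by_contra hb
    have := hT (T b) (by omega)
    rw [content_apply, Finset.card_eq_zero, Finset.filter_eq_empty_iff] at this
    exact this (Finset.mem_univ b) rfl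
  have hss : ∀ {E E' : Diagram} (T : E → ℕ) (e : E' → E), (∀ b, (e b).1 = -b.1) →
      (∀ b, T b ≤ n) → IsSSYT T → IsSSYT (ρ ∘ T ∘ e) := by
    intro E E' T e he hT hS
    refine ⟨fun b b' h1 h2 => ?_, fun b b' h1 h2 => ?_⟩
    · have := hS.1 (e b') (e b) (by simp [he, h1]) (by simp [he, h2])
      simp only [Function.comp_apply, hval _ (hT _)]
      omega
    · have := hS.2 (e b') (e b) (by simp [he, h1]) (by simp [he, h2])
      have := hT (e b)
      simp only [Function.comp_apply, hval _ (hT _)]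
      omega
  have h1 : ∀ a : ℕ → ℕ, (∀ i, n < i → a i = 0) →
      fillCount (rotate D) (a ∘ ρ) = fillCount D a := by
    intro a ha
    conv_lhs => rw [← hsymm]
    refine fillCount_congr (rotateEquiv D) ρ a (fun T h hT => ?_) fun T h hT => ?_
    · exact hss T _ (fun b => rfl) (hle T fun i hi => by rw [h, ha i hi]) hT
    · rw [hsymm]
      refine hss T _ (fun b => rfl) (hle T fun i hi => ?_) hT
      rw [h, hsymm, Function.comp_apply, hval' i hi, ha i hi]
  have h2 := h1 (m ∘ ρ) fun i hi => by rw [Function.comp_apply, hval' i hi, hn i hi]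
  have h3 : (m ∘ ρ) ∘ ρ = m := by
    funext i
    have := ρ.symm_apply_apply i
    rw [hsymm] at this
    exact congrArg m this
  rw [h3] at h2
  rw [h2]
  exact congrArg _ (fillCount_perm hD n _ m)

/-! ### The Littlewood–Richardson rule by a sign-reversing involution -/

open Classical in
/-- The semistandard fillings of `D` with letters less than `N`. -/
noncomputable def fillings (N : ℕ) (D : Diagram) : Finset (D → ℕ) :=
  (Fintype.piFinset fun _ => Finset.range N).filter IsSSYT

theorem mem_fillings {N : ℕ} {D : Diagram} {T : D → ℕ} :
    T ∈ fillings N D ↔ (∀ b, T b < N) ∧ IsSSYT T := by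
  simp [fillings]

/-- The coefficient at `m` of the linear functional which, on symmetric functions, extracts the
coefficient of the Schur function with shifted exponents `ρ`. -/
noncomputable def alternant (N : ℕ) (ρ : Fin N → ℕ) (m : ℕ → ℕ) : ℤ :=
  Matrix.det (Matrix.of fun i j : Fin N => if m i + (N - 1 - i) = ρ j then (1 : ℤ) else 0)

/-- On symmetric functions of degree `d` in the first `N` variables: the coefficient of the Schur
function with shifted exponents `ρ`. -/
noncomputable def schurCoeff (N d : ℕ) (ρ : Fin N → ℕ) : MvPowerSeries ℕ ℤ →ₗ[ℤ] ℤ where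
  toFun f := ∑ m ∈ Finset.finsuppAntidiag (Finset.range N) d, alternant N ρ m * f m
  map_add' f g := by
    rw [← Finset.sum_add_distrib]
    exact Finset.sum_congr rfl fun m _ => mul_add _ _ _
  map_smul' c f := by
    rw [RingHom.id_apply, smul_eq_mul, Finset.mul_sum]
    exact Finset.sum_congr rfl fun m _ => mul_left_comm _ _ _

theorem schurCoeff_apply (N d : ℕ) (ρ : Fin N → ℕ) (f : MvPowerSeries ℕ ℤ) :
    schurCoeff N d ρ f = ∑ m ∈ Finset.finsuppAntidiag (Finset.range N) d, alternant N ρ m * f m :=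
  rfl

/-- In terms of the shifted exponents `m i + (N - 1 - i)` the hypotheses say that entries `k` and `k
+ 1` are exchanged, which exchanges two rows of the determinant. The shift accounts for the `+ 1`.
-/
theorem alternant_swap {N : ℕ} (ρ : Fin N → ℕ) {m m' : ℕ → ℕ} {k : ℕ} (hk : k + 1 < N)
    (h1 : m' k + 1 = m (k + 1)) (h2 : m' (k + 1) = m k + 1)
    (h3 : ∀ l, l ≠ k → l ≠ k + 1 → m' l = m l) : alternant N ρ m + alternant N ρ m' = 0 := by
  have hne : (⟨k, by omega⟩ : Fin N) ≠ ⟨k + 1, hk⟩ := by simp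
  have := Matrix.det_permute (Equiv.swap (⟨k, by omega⟩ : Fin N) ⟨k + 1, hk⟩)
    (Matrix.of fun i j : Fin N => if m i + (N - 1 - i) = ρ j then (1 : ℤ) else 0)
  rw [Equiv.Perm.sign_swap hne] at this
  have h4 : alternant N ρ m' = - alternant N ρ m := by
    rw [alternant, alternant]
    trans
    swap
    · simpa using this
    congr 1
    ext i j
    simp only [Matrix.of_apply, Matrix.submatrix_apply, id]
    rcases eq_or_ne i ⟨k, by omega⟩ with rfl | hi
    · rw [Equiv.swap_apply_left]
      simp only
      rw [show m' k + (N - 1 - k) = m (k + 1) + (N - 1 - (k + 1)) by omega]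
    · rcases eq_or_ne i ⟨k + 1, hk⟩ with rfl | hi'
      · rw [Equiv.swap_apply_right]
        simp only
        rw [show m' (k + 1) + (N - 1 - (k + 1)) = m k + (N - 1 - k) by omega]
      · rw [Equiv.swap_apply_of_ne_of_ne hi hi', h3 i (fun h => hi (Fin.ext h))
          fun h => hi' (Fin.ext h)]
  rw [h4, add_neg_cancel]

theorem exists_perm_of_alternant_ne_zero {N : ℕ} {ρ : Fin N → ℕ} {m : ℕ → ℕ}
    (h : alternant N ρ m ≠ 0) : ∃ σ : Equiv.Perm (Fin N), ∀ i, m (σ i) + (N - 1 - σ i) = ρ i := by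
  rw [alternant, Matrix.det_apply] at h
  obtain ⟨σ, -, hσ⟩ := Finset.exists_ne_zero_of_sum_ne_zero h
  refine ⟨σ, fun i => ?_⟩
  by_contra hi
  apply hσ
  rw [Finset.prod_eq_zero (Finset.mem_univ i), smul_zero]
  rw [Matrix.of_apply, if_neg hi]

theorem strictAnti_shift {N : ℕ} {m : ℕ → ℕ} (hm : ∀ k, k + 1 < N → m (k + 1) ≤ m k) :
    StrictAnti fun i : Fin N => m i + (N - 1 - i) := by
  have h : ∀ d k, k + d < N → m (k + d) ≤ m k := by
    intro d
    induction d with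
    | zero => intro k _; exact le_rfl
    | succ d ih => intro k hk; exact (hm _ hk).trans (ih k (by omega))
  intro i j hij
  have := h (j - i) i (by omega)
  rw [show (i : ℕ) + (j - i) = j by omega] at this
  have := j.2
  have : (i : ℕ) < j := hij
  simp only
  omega

/-- A nonzero determinant makes the two sequences of shifted exponents permutations of each other.
Both are strictly decreasing, so the permutation is the identity. -/
theorem eq_of_alternant_ne_zero {N : ℕ} {lam m : ℕ → ℕ}
    (hm : ∀ k, k + 1 < N → m (k + 1) ≤ m k) (hl : ∀ k, k + 1 < N → lam (k + 1) ≤ lam k)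
    (h : alternant N (fun i => lam i + (N - 1 - i)) m ≠ 0) : ∀ i < N, m i = lam i := by
  obtain ⟨σ, hσ⟩ := exists_perm_of_alternant_ne_zero h
  have h1 := strictAnti_shift hm
  have h2 := strictAnti_shift hl
  have hs : StrictMono σ := by
    intro i j hij
    have := h2 hij
    simp only [← hσ] at this
    exact h1.lt_iff_gt.1 this
  have h3 : ∀ i, σ i = i := fun i => by
    have := Subsingleton.elim (hs.orderIsoOfSurjective σ σ.surjective) (OrderIso.refl (Fin N))
    exact DFunLike.congr_fun this i
  intro i hi
  have := hσ ⟨i, hi⟩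
  rw [h3] at this
  simpa using this

theorem alternant_self {N : ℕ} {lam m : ℕ → ℕ} (hl : ∀ k, k + 1 < N → lam (k + 1) ≤ lam k)
    (h : ∀ i < N, m i = lam i) : alternant N (fun i => lam i + (N - 1 - i)) m = 1 := by
  have : (Matrix.of fun i j : Fin N =>
      if m i + (N - 1 - i) = lam j + (N - 1 - j) then (1 : ℤ) else 0) = 1 := by
    ext i j
    rw [Matrix.of_apply, h i i.2, Matrix.one_apply]
    refine if_congr ?_ rfl rfl
    exact (strictAnti_shift hl).injective.eq_iff (a := i) (b := j)
  rw [alternant, this, Matrix.det_one]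

theorem content_mem_finsuppAntidiag {D : Diagram} (T : D → ℕ) (N : ℕ) (h : ∀ b, T b < N) :
    content T ∈ Finset.finsuppAntidiag (Finset.range N) D.card := by
  rw [Finset.mem_finsuppAntidiag]
  constructor
  · simp only [content_apply]
    rw [← Finset.card_eq_sum_card_fiberwise (fun b _ => by simpa using h b)]
    simp
  · intro k hk
    rw [Finsupp.mem_support_iff, content_apply] at hk
    obtain ⟨b, hb⟩ := Finset.card_pos.1 (Nat.pos_of_ne_zero hk)
    rw [Finset.mem_filter] at hb
    rw [Finset.mem_range, ← hb.2]
    exact h b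

theorem lt_of_content_support {D : Diagram} {T : D → ℕ} {N : ℕ}
    (h : (content T).support ⊆ Finset.range N) (b : D) : T b < N := by
  rw [← Finset.mem_range]
  apply h
  rw [Finsupp.mem_support_iff, content_apply]
  exact (Finset.card_pos.2 ⟨b, by simp⟩).ne'

open Classical in
theorem schurCoeff_schur_eq_sum (N : ℕ) (D : Diagram) (ρ : Fin N → ℕ) :
    schurCoeff N D.card ρ (schur D) = ∑ T ∈ fillings N D, alternant N ρ (content T) := by
  rw [schurCoeff_apply, ← Finset.sum_fiberwise_of_maps_to (g := fun T : D → ℕ => content T)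
    (t := Finset.finsuppAntidiag (Finset.range N) D.card)
    fun T hT => content_mem_finsuppAntidiag T N (mem_fillings.1 hT).1]
  refine Finset.sum_congr rfl fun m hm => ?_
  have h1 : schur D m = ((fillings N D).filter fun T => content T = m).card := by
    rw [schur, ← Set.ncard_coe_finset]
    congr 2
    ext T
    simp only [Set.mem_ofPred_eq, Finset.coe_filter, mem_fillings]
    constructor
    · rintro ⟨h1, h2⟩
      refine ⟨⟨fun b => ?_, h1⟩, h2⟩
      exact lt_of_content_support (h2 ▸ (Finset.mem_finsuppAntidiag.1 hm).2) b
    · rintro ⟨⟨_, h1⟩, h2⟩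
      exact ⟨h1, h2⟩
  rw [h1, Finset.sum_congr rfl fun T hT => by rw [(Finset.mem_filter.1 hT).2], Finset.sum_const,
    nsmul_eq_mul, mul_comm]

/-- Littlewood–Richardson fillings: if the columns are read from right to left, then at every time
there are at least as many letters `k` as letters `k + 1`. -/
def IsLR {D : Diagram} (T : D → ℕ) : Prop :=
  ∀ j k, countRight T j (k + 1) ≤ countRight T j k

/-- The first violation, from the right, of the Littlewood–Richardson condition. -/
def IsFirstViolation {D : Diagram} (T : D → ℕ) (p : ℤ × ℕ) : Prop :=
  countRight T p.1 p.2 < countRight T p.1 (p.2 + 1) ∧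
    (∀ j, p.1 < j → ∀ k, countRight T j (k + 1) ≤ countRight T j k) ∧
    ∀ k < p.2, countRight T p.1 (k + 1) ≤ countRight T p.1 k

section violation
variable {D : Diagram} {T : D → ℕ}

theorem exists_isFirstViolation (h : ¬ IsLR T) : ∃ p, IsFirstViolation T p := by
  classical
  rw [IsLR] at h
  push Not at h
  obtain ⟨B, hB⟩ := exists_col_bound D
  obtain ⟨j, hj, hmax⟩ := Int.exists_greatest_of_bdd
    (P := fun j => ∃ k, countRight T j k < countRight T j (k + 1)) ⟨B, by
      rintro z ⟨k, hk⟩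
      by_contra hz
      rw [countRight_eq_zero (fun b => (hB b).trans (not_le.1 hz)) T (k + 1)] at hk
      omega⟩ h
  refine ⟨(j, Nat.find hj), Nat.find_spec hj, fun j' hj' k => ?_, fun k hk => ?_⟩
  · by_contra hc
    exact absurd (hmax j' ⟨k, not_le.1 hc⟩) (not_le.2 hj')
  · exact not_lt.1 (Nat.find_min hj hk)

theorem IsFirstViolation.unique {p q : ℤ × ℕ} (hp : IsFirstViolation T p)
    (hq : IsFirstViolation T q) : p = q := by
  have h1 : p.1 = q.1 := by
    rcases lt_trichotomy p.1 q.1 with h | h | h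
    · exact absurd (hp.2.1 _ h q.2) (not_le.2 hq.1)
    · exact h
    · exact absurd (hq.2.1 _ h p.2) (not_le.2 hp.1)
  refine Prod.ext h1 ?_
  rcases lt_trichotomy p.2 q.2 with h | h | h
  · exact absurd (hq.2.2 _ h) (not_le.2 (h1 ▸ hp.1))
  · exact h
  · exact absurd (hp.2.2 _ h) (not_le.2 (h1 ▸ hq.1))

theorem IsFirstViolation.congr {T' : D → ℕ} {p : ℤ × ℕ} (hp : IsFirstViolation T p)
    (h : ∀ b : D, p.1 ≤ b.1.2 → T' b = T b) : IsFirstViolation T' p := by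
  have key : ∀ j, p.1 ≤ j → ∀ k, countRight T' j k = countRight T j k := by
    intro j hj k
    rw [countRight, countRight]
    congr 1
    ext b
    simp only [Finset.mem_filter, Finset.mem_univ, true_and]
    refine and_congr_right fun hb => ?_
    rw [h b (hj.trans hb)]
  refine ⟨?_, fun j hj k => ?_, fun k hk => ?_⟩
  · rw [key _ le_rfl, key _ le_rfl]; exact hp.1
  · rw [key _ hj.le, key _ hj.le]; exact hp.2.1 j hj k
  · rw [key _ le_rfl, key _ le_rfl]; exact hp.2.2 k hk

theorem countRight_eq_add (T : D → ℕ) (j : ℤ) (k : ℕ) : countRight T j k =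
    countRight T (j + 1) k + (Finset.univ.filter fun b : D => b.1.2 = j ∧ T b = k).card := by
  classical
  rw [countRight, countRight, ← Finset.card_union_of_disjoint]
  · congr 1
    ext b
    simp only [Finset.mem_filter, Finset.mem_univ, true_and, Finset.mem_union]
    have : j ≤ b.1.2 ↔ j + 1 ≤ b.1.2 ∨ b.1.2 = j := by omega
    tauto
  · rw [Finset.disjoint_left]
    intro b h h'
    simp only [Finset.mem_filter] at h h'
    omega

theorem card_col_le_one (hT : IsSSYT T) (j : ℤ) (k : ℕ) :
    (Finset.univ.filter fun b : D => b.1.2 = j ∧ T b = k).card ≤ 1 := by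
  rw [Finset.card_le_one]
  intro b hb b' hb'
  simp only [Finset.mem_filter, Finset.mem_univ, true_and] at hb hb'
  rcases lt_trichotomy b.1.1 b'.1.1 with h | h | h
  · have := hT.2 b b' (hb.1.trans hb'.1.symm) h
    omega
  · exact Subtype.ext (Prod.ext h (hb.1.trans hb'.1.symm))
  · have := hT.2 b' b (hb'.1.trans hb.1.symm) h
    omega

/-- There is no violation one column further right, and a column contains each letter at most once.
So the deficit can only be 1, and column `p.1` contributes a `k + 1` but no `k`, for `k = p.2`. The
absence of `k` is what `isSSYT_benderKnuth` requires. -/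
theorem IsFirstViolation.spec (hT : IsSSYT T) {p : ℤ × ℕ} (hp : IsFirstViolation T p) :
    (∀ b : D, b.1.2 = p.1 → T b ≠ p.2) ∧
      countRight T p.1 (p.2 + 1) = countRight T p.1 p.2 + 1 := by
  have h1 := hp.1
  have h2 := hp.2.1 (p.1 + 1) (by omega) p.2
  have h3 := countRight_eq_add T p.1 (p.2 + 1)
  have h4 := countRight_eq_add T p.1 p.2
  have h5 := card_col_le_one hT p.1 (p.2 + 1)
  have h6 : (Finset.univ.filter fun b : D => b.1.2 = p.1 ∧ T b = p.2).card = 0 := by omega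
  refine ⟨fun b hb hk => ?_, by omega⟩
  rw [Finset.card_eq_zero, Finset.filter_eq_empty_iff] at h6
  exact h6 (Finset.mem_univ b) ⟨hb, hk⟩

open Classical in
/-- The sign-reversing involution on the fillings which violate the Littlewood–Richardson
condition. -/
noncomputable def swapViolation (T : D → ℕ) : D → ℕ :=
  if h : ∃ p, IsFirstViolation T p then benderKnuth T h.choose.1 h.choose.2 else T

theorem swapViolation_eq {p : ℤ × ℕ} (hp : IsFirstViolation T p) :
    swapViolation T = benderKnuth T p.1 p.2 := by
  have h : ∃ p, IsFirstViolation T p := ⟨p, hp⟩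
  rw [swapViolation, dif_pos h, h.choose_spec.unique hp]

theorem IsFirstViolation.swapViolation {p : ℤ × ℕ} (hp : IsFirstViolation T p) :
    IsFirstViolation (swapViolation T) p := by
  rw [swapViolation_eq hp]
  exact hp.congr fun b hb => benderKnuth_of_le hb

theorem swapViolation_swapViolation {p : ℤ × ℕ} (hp : IsFirstViolation T p) :
    swapViolation (swapViolation T) = T := by
  rw [swapViolation_eq hp.swapViolation, swapViolation_eq hp, benderKnuth_benderKnuth]

end violation

/-- Exchanging `k` and `k + 1` strictly left of the first violation leaves that violation in place,
so the map is an involution. As `k + 1` leads by exactly one in the untouched columns, the two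
contents are related as in `alternant_swap` and the terms cancel. -/
theorem sum_alternant_not_isLR {D : Diagram} (hD : (D : Set (ℤ × ℤ)).OrdConnected) (N : ℕ)
    (ρ : Fin N → ℕ) [DecidablePred (IsLR (D := D))] :
    ∑ T ∈ (fillings N D).filter fun T => ¬ IsLR T, alternant N ρ (content T) = 0 := by
  have hadd : ∀ T ∈ (fillings N D).filter fun T => ¬ IsLR T,
      alternant N ρ (content T) + alternant N ρ (content (swapViolation T)) = 0 := by
    intro T hT
    rw [Finset.mem_filter, mem_fillings] at hT
    obtain ⟨⟨hN, hS⟩, hLR⟩ := hT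
    obtain ⟨⟨j, k⟩, hp⟩ := exists_isFirstViolation hLR
    obtain ⟨hk, hr⟩ := hp.spec hS
    simp only at hk hr
    rw [show swapViolation T = benderKnuth T j k from swapViolation_eq hp]
    have hpos : 0 < countRight T j (k + 1) := by omega
    obtain ⟨b, hb⟩ := Finset.card_pos.1 hpos
    have hkN : k + 1 < N := by rw [← (Finset.mem_filter.1 hb).2.2]; exact hN b
    have hc := fun (T : D → ℕ) l => content_eq_add T j l
    refine alternant_swap ρ hkN ?_ ?_ fun l h1 h2 => ?_
    · rw [hc, hc, countRight_benderKnuth, countLeft_benderKnuth hS]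
      omega
    · rw [hc, hc, countRight_benderKnuth,
        countLeft_benderKnuth_succ (isSSYT_benderKnuth hD hS hk)]
      omega
    · rw [hc, hc, countRight_benderKnuth, countLeft_benderKnuth_of_ne h1 h2]
  refine Finset.sum_involution (fun T _ => swapViolation T) hadd (fun T hT h0 heq => ?_)
    (fun T hT => ?_) fun T hT => ?_
  · have := hadd T hT
    rw [heq] at this
    -- If the filling were fixed, its term would equal its own negative and vanish.
    omega
  · rw [Finset.mem_filter, mem_fillings] at hT ⊢
    obtain ⟨⟨hN, hS⟩, hLR⟩ := hT
    obtain ⟨⟨j, k⟩, hp⟩ := exists_isFirstViolation hLR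
    obtain ⟨hk, hr⟩ := hp.spec hS
    simp only at hk hr
    have hpos : 0 < countRight T j (k + 1) := by omega
    obtain ⟨b, hb⟩ := Finset.card_pos.1 hpos
    have hkN : k + 1 < N := by rw [← (Finset.mem_filter.1 hb).2.2]; exact hN b
    refine ⟨⟨fun b => ?_, ?_⟩, fun h => absurd (h j k) (not_le.2 hp.swapViolation.1)⟩
    · rw [swapViolation_eq hp]
      simp only
      by_cases ha : Active T j k b
      · have := benderKnuth_mem_pair ha
        omega
      · rw [benderKnuth_of_not_active ha]
        exact hN b
    · rw [swapViolation_eq hp]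
      exact isSSYT_benderKnuth hD hS hk
  · rw [Finset.mem_filter] at hT
    obtain ⟨p, hp⟩ := exists_isFirstViolation hT.2
    exact swapViolation_swapViolation hp

theorem IsLR.content_succ_le {D : Diagram} {T : D → ℕ} (hT : IsLR T) (k : ℕ) :
    content T (k + 1) ≤ content T k := by
  obtain ⟨p, hp⟩ : ∃ p : ℤ × ℤ, ∀ b ∈ D, p ≤ b := D.bddBelow
  have : ∀ k, content T k = countRight T p.2 k := by
    intro k
    rw [content_apply, countRight]
    congr 1
    ext b
    simp only [Finset.mem_filter, Finset.mem_univ, true_and]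
    exact ⟨fun h => ⟨(hp b.1 b.2).2, h⟩, fun h => h.2⟩
  rw [this, this]
  exact hT _ _

open Classical in
/-- A form of the Littlewood–Richardson rule. -/
theorem schurCoeff_schur {D : Diagram} (hD : (D : Set (ℤ × ℤ)).OrdConnected) (N : ℕ) (lam : ℕ →₀ ℕ)
    (hl : ∀ k, lam (k + 1) ≤ lam k) (hN : ∀ k, N ≤ k → lam k = 0) :
    schurCoeff N D.card (fun i => lam i + (N - 1 - i)) (schur D) =
      ((fillings N D).filter fun T => IsLR T ∧ content T = lam).card := by
  rw [schurCoeff_schur_eq_sum, ← Finset.sum_filter_add_sum_filter_not _ IsLR,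
    sum_alternant_not_isLR hD, add_zero, Finset.card_eq_sum_ones, ← Finset.filter_filter,
    Finset.sum_filter (fun T : D → ℕ => content T = lam)]
  push_cast
  refine Finset.sum_congr rfl fun T hT => ?_
  rw [Finset.mem_filter, mem_fillings] at hT
  obtain ⟨⟨h1, _⟩, h2⟩ := hT
  split_ifs with h
  -- The surviving contents are partitions, so each alternant is 1 or 0 according to whether the
  -- content is `lam`.
  · exact alternant_self (fun k _ => hl k) fun i _ => by rw [h]
  · by_contra h0
    have h3 := eq_of_alternant_ne_zero (fun k _ => h2.content_succ_le k) (fun k _ => hl k) h0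
    apply h
    ext k
    rcases lt_or_ge k N with hk | hk
    · exact h3 k hk
    · rw [hN k hk]
      by_contra hc
      have := (Finset.mem_finsuppAntidiag.1 (content_mem_finsuppAntidiag T N h1)).2 (Finsupp.mem_support_iff.2 hc)
      rw [Finset.mem_range] at this
      omega

/-! ### Littlewood–Richardson fillings of a Ferrers diagram -/

/-- `D` is the Ferrers diagram with row lengths `lam`. -/
def IsShape (D : Diagram) (lam : ℕ → ℕ) : Prop :=
  ∀ b : ℤ × ℤ, b ∈ D ↔ ∃ r c : ℕ, b = ((r : ℤ), (c : ℤ)) ∧ c < lam r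

/-- The filling of a Ferrers diagram in which every box contains the number of its row. -/
def rowFilling (D : Diagram) (b : D) : ℕ := b.1.1.toNat

/-- One step up is an injection from the boxes with `k + 1` to those with `k`, within the same
columns. -/
theorem card_filter_le_of_above {D : Diagram} {T : D → ℕ} {k : ℕ} {P : ℤ → Prop} [DecidablePred P]
    (h : ∀ b : D, P b.1.2 → T b = k + 1 → ∃ b' : D, b'.1 = (b.1.1 - 1, b.1.2) ∧ T b' = k) :
    (Finset.univ.filter fun b : D => P b.1.2 ∧ T b = k + 1).card ≤
      (Finset.univ.filter fun b : D => P b.1.2 ∧ T b = k).card := by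
  choose! f hf hf' using h
  refine Finset.card_le_card_of_injOn f (fun b hb => ?_) fun b hb b' hb' h => ?_
  · simp only [Finset.coe_filter, Finset.mem_univ, true_and, Set.mem_ofPred_eq] at hb ⊢
    rw [hf b hb.1 hb.2]
    exact ⟨hb.1, hf' b hb.1 hb.2⟩
  · simp only [Finset.coe_filter, Finset.mem_univ, true_and, Set.mem_ofPred_eq] at hb hb'
    have := congrArg Subtype.val h
    rw [hf b hb.1 hb.2, hf b' hb'.1 hb'.2, Prod.mk.injEq] at this
    exact Subtype.ext (Prod.ext (by omega) this.2)

section shape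
variable {D : Diagram} {lam : ℕ → ℕ}

theorem IsShape.mem_iff (hD : IsShape D lam) (r c : ℕ) :
    ((r : ℤ), (c : ℤ)) ∈ D ↔ c < lam r := by
  rw [hD]
  constructor
  · rintro ⟨r', c', h, hc⟩
    rw [Prod.mk.injEq, Nat.cast_inj, Nat.cast_inj] at h
    rw [h.1, h.2]
    exact hc
  · exact fun h => ⟨r, c, rfl, h⟩

theorem IsShape.mem_of_le (hD : IsShape D lam) (hl : Antitone lam) {b : ℤ × ℤ} (hb : b ∈ D)
    {x : ℤ × ℤ} (h0 : 0 ≤ x) (h : x ≤ b) : x ∈ D := by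
  obtain ⟨r, c, rfl, hc⟩ := (hD b).1 hb
  obtain ⟨h1, h2⟩ := h
  obtain ⟨h3, h4⟩ := h0
  simp only [Prod.fst_zero, Prod.snd_zero] at h1 h2 h3 h4
  have : x = ((x.1.toNat : ℤ), (x.2.toNat : ℤ)) := Prod.ext (by simp only; omega)
    (by simp only; omega)
  rw [this, hD.mem_iff]
  have := hl (show x.1.toNat ≤ r by omega)
  omega

theorem IsShape.nonneg (hD : IsShape D lam) {b : ℤ × ℤ} (hb : b ∈ D) : 0 ≤ b := by
  obtain ⟨r, c, rfl, hc⟩ := (hD b).1 hb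
  exact ⟨Int.natCast_nonneg _, Int.natCast_nonneg _⟩

theorem IsShape.ordConnected (hD : IsShape D lam) (hl : Antitone lam) :
    (D : Set (ℤ × ℤ)).OrdConnected :=
  ⟨fun _ hx _ hy _ hz => hD.mem_of_le hl hy ((hD.nonneg hx).trans hz.1) hz.2⟩

theorem IsShape.cast_rowFilling (hD : IsShape D lam) (b : D) : (rowFilling D b : ℤ) = b.1.1 :=
  Int.toNat_of_nonneg (hD.nonneg b.2).1

theorem IsShape.isSSYT_rowFilling (hD : IsShape D lam) : IsSSYT (rowFilling D) := by
  refine ⟨fun b b' h _ => ?_, fun b b' _ h => ?_⟩ <;>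
  · have := hD.cast_rowFilling b
    have := hD.cast_rowFilling b'
    omega

theorem IsShape.isLR_rowFilling (hD : IsShape D lam) (hl : Antitone lam) :
    IsLR (rowFilling D) := by
  intro j k
  refine card_filter_le_of_above (P := fun c => j ≤ c) fun b _ hb => ?_
  have h1 := hD.cast_rowFilling b
  have h2 := hD.nonneg b.2
  have hm : (b.1.1 - 1, b.1.2) ∈ D := hD.mem_of_le hl b.2
    ⟨by simp only [Prod.fst_zero]; omega, h2.2⟩ ⟨by simp, le_rfl⟩
  refine ⟨⟨_, hm⟩, rfl, ?_⟩
  have := hD.cast_rowFilling ⟨_, hm⟩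
  simp only at this
  omega

theorem IsShape.content_rowFilling (hD : IsShape D lam) (r : ℕ) :
    content (rowFilling D) r = lam r := by
  rw [content_apply, ← Finset.card_range (lam r)]
  symm
  refine Finset.card_bij (fun c hc => ⟨((r : ℤ), (c : ℤ)), (hD.mem_iff r c).2
    (Finset.mem_range.1 hc)⟩) ?_ ?_ ?_
  · intro c hc
    rw [Finset.mem_filter]
    exact ⟨Finset.mem_univ _, Int.toNat_natCast r⟩
  · intro c _ c' _ h
    simpa using h
  · rintro ⟨b, hb⟩ h
    obtain ⟨r', c, rfl, hc⟩ := (hD b).1 hb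
    obtain rfl : r' = r := by simpa [rowFilling] using (Finset.mem_filter.1 h).2
    exact ⟨c, Finset.mem_range.2 hc, rfl⟩

/-- With the next lemmas this says that the Schur function of a Ferrers diagram has a single nonzero
Schur coefficient. At the first box that deviates, in the reading order, the letter exceeds the row
number; the Littlewood–Richardson condition then asks for the preceding letter in a place where it
cannot occur. -/
theorem IsShape.eq_rowFilling (hD : IsShape D lam) (hl : Antitone lam) {T : D → ℕ} (hT : IsSSYT T)
    (hLR : IsLR T) : T = rowFilling D := by
  classical
  by_contra hne
  obtain ⟨b₀, hb₀⟩ := Function.ne_iff.1 hne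
  obtain ⟨b, hb, hmax⟩ := Finset.exists_max_image
    (Finset.univ.filter fun b : D => T b ≠ rowFilling D b)
    -- The rightmost column with a deviation, and its topmost deviating box.
    (fun b => toLex (b.1.2, -b.1.1)) ⟨b₀, by simpa using hb₀⟩
  simp only [Finset.mem_filter, Finset.mem_univ, true_and, Prod.Lex.toLex_le_toLex] at hb hmax
  have hright : ∀ x : D, b.1.2 < x.1.2 → T x = rowFilling D x := by
    intro x hx
    by_contra h
    have := hmax x h
    omega
  have hup : ∀ x : D, x.1.2 = b.1.2 → x.1.1 < b.1.1 → T x = rowFilling D x := by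
    intro x hx hx'
    by_contra h
    have := hmax x h
    omega
  have hrb := hD.cast_rowFilling b
  have h0 := hD.nonneg b.2
  have hge : rowFilling D b < T b := by
    refine lt_of_le_of_ne ?_ hb.symm
    rcases Nat.eq_zero_or_pos (rowFilling D b) with h | h
    · rw [h]; exact Nat.zero_le _
    · have hm : (b.1.1 - 1, b.1.2) ∈ D := hD.mem_of_le hl b.2
        ⟨by simp only [Prod.fst_zero]; omega, h0.2⟩ ⟨by simp, le_rfl⟩
      have h1 := hup ⟨_, hm⟩ rfl (by simp)
      have h2 := hD.cast_rowFilling ⟨_, hm⟩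
      have h3 := hT.2 ⟨_, hm⟩ b rfl (by simp)
      simp only at h2
      omega
  have h1 := hLR b.1.2 (T b - 1)
  rw [show T b - 1 + 1 = T b by omega] at h1
  have h2 : 0 < countRight T b.1.2 (T b) := Finset.card_pos.2 ⟨b, by simp⟩
  obtain ⟨x, hx⟩ := Finset.card_pos.1 (h2.trans_le h1)
  simp only [Finset.mem_filter, Finset.mem_univ, true_and] at hx
  have hrx := hD.cast_rowFilling x
  rcases hx.1.lt_or_eq with h | h
  · have h3 := hright x h
    -- A column further right reaches at least to the row of `b`, so `b` has a right neighbour; its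
    -- letter is the row number, too small for `T b`.
    have hm : (b.1.1, b.1.2 + 1) ∈ D := hD.mem_of_le hl x.2
      ⟨h0.1, by have := h0.2; simp only [Prod.snd_zero] at this ⊢; omega⟩
      ⟨by simp only; omega, by simp only; omega⟩
    have h4 := hright ⟨_, hm⟩ (by simp)
    have h5 := hT.1 b ⟨_, hm⟩ rfl (by simp)
    have h6 := hD.cast_rowFilling ⟨_, hm⟩
    simp only at h6
    omega
  · rcases lt_trichotomy x.1.1 b.1.1 with h3 | h3 | h3
    · have := hup x h.symm h3
      omega
    · have : x = b := Subtype.ext (Prod.ext h3 h.symm)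
      rw [this] at hx
      omega
    · have := hT.2 b x h h3
      omega

end shape

theorem isShape_ferrers (w : List ℕ) : IsShape (ferrers w) fun r => w.getD r 0 := by
  intro b
  simp only [ferrers, Finset.mem_biUnion, Finset.mem_range, Finset.mem_image]
  constructor
  · rintro ⟨r, -, c, hc, rfl⟩
    exact ⟨r, c, rfl, hc⟩
  · rintro ⟨r, c, rfl, hc⟩
    refine ⟨r, ?_, c, hc, rfl⟩
    by_contra h
    rw [List.getD_eq_default _ _ (not_lt.1 h)] at hc
    omega

/-! ### Fat staircases as partitions with steps of at most 1 -/

/-- The row lengths of the fat staircase of the composition `α`. -/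
def stairRows (α : List ℕ) : List ℕ :=
  (α.mapIdx fun i a => List.replicate a (i + 1)).flatten.reverse

theorem stairRows_append (β : List ℕ) (a : ℕ) :
    stairRows (β ++ [a]) = List.replicate a (β.length + 1) ++ stairRows β := by
  simp [stairRows, List.mapIdx_append]

theorem getD_stairRows_append (β : List ℕ) (a r : ℕ) : (stairRows (β ++ [a])).getD r 0 =
    if r < a then β.length + 1 else (stairRows β).getD (r - a) 0 := by
  rw [stairRows_append]
  split_ifs with h
  · rw [List.getD_append _ _ _ _ (by simpa using h), List.getD_eq_getElem _ _ (by simpa using h),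
      List.getElem_replicate]
  · rw [List.getD_append_right _ _ _ _ (by simpa using h), List.length_replicate]

/-- The last entry of `α` counts the longest rows, which come on top. The default value `0` of
`getD` includes the step from the last row to the empty rows. -/
theorem stairRows_spec (α : List ℕ) (hα : ∀ a ∈ α, 0 < a) :
    (stairRows α).getD 0 0 = α.length ∧
      ∀ r, (stairRows α).getD (r + 1) 0 ≤ (stairRows α).getD r 0 ∧
        (stairRows α).getD r 0 ≤ (stairRows α).getD (r + 1) 0 + 1 := by
  induction α using List.reverseRecOn with
  | nil => simp [stairRows]
  | append_singleton β a ih =>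
    have ha : 0 < a := hα a (by simp)
    obtain ⟨h0, ih⟩ := ih fun x hx => hα x (by simp [hx])
    have hle : ∀ r, (stairRows β).getD r 0 ≤ β.length := by
      intro r
      induction r with
      | zero => exact h0.le
      | succ r ihr => exact (ih r).1.trans ihr
    refine ⟨by rw [getD_stairRows_append, if_pos ha]; simp, fun r => ?_⟩
    rw [getD_stairRows_append, getD_stairRows_append]
    by_cases h1 : r + 1 < a
    · rw [if_pos h1, if_pos (by omega)]
      omega
    · rw [if_neg h1]
      by_cases h2 : r < a
      · rw [if_pos h2, show r + 1 - a = 0 by omega, h0]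
        omega
      · rw [if_neg h2, show r + 1 - a = r - a + 1 by omega]
        exact ih _

theorem exists_stairRows (n : ℕ) : ∀ lam : ℕ → ℕ, lam 0 = n → (∃ B, lam B = 0) →
    (∀ r, lam (r + 1) ≤ lam r ∧ lam r ≤ lam (r + 1) + 1) →
    ∃ α : List ℕ, (∀ a ∈ α, 0 < a) ∧ α.length = n ∧ ∀ r, (stairRows α).getD r 0 = lam r := by
  induction n with
  | zero =>
    intro lam h0 _ hl
    refine ⟨[], by simp, rfl, fun r => ?_⟩
    have : lam r ≤ lam 0 := antitone_nat_of_succ_le (fun r => (hl r).1) (Nat.zero_le r)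
    simp [stairRows]
    omega
  | succ n ih =>
    intro lam h0 hB hl
    have hanti : Antitone lam := antitone_nat_of_succ_le fun r => (hl r).1
    have hex : ∃ a, lam a ≤ n := hB.imp fun B h => by omega
    -- `a` is the number of rows of full length `n + 1`; it becomes the last entry of the
    -- composition, and the rows below are treated by induction.
    obtain ⟨a, ha, hmin⟩ : ∃ a, lam a ≤ n ∧ ∀ r < a, n < lam r := by
      classical
      exact ⟨Nat.find hex, Nat.find_spec hex, fun r hr => not_le.1 (Nat.find_min hex hr)⟩
    have hapos : 0 < a := by
      rcases Nat.eq_zero_or_pos a with rfl | h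
      · omega
      · exact h
    have han : lam a = n := by
      have h1 := (hl (a - 1)).2
      rw [show a - 1 + 1 = a by omega] at h1
      have := hmin (a - 1) (by omega)
      omega
    obtain ⟨β, h1, h2, h3⟩ := ih (fun r => lam (r + a)) (by simpa using han)
      (hB.imp fun B h => Nat.le_zero.1 ((hanti (Nat.le_add_right B a)).trans h.le))
      (fun r => by have := hl (r + a); rwa [show r + a + 1 = r + 1 + a by omega] at this)
    refine ⟨β ++ [a], ?_, by simp [h2], fun r => ?_⟩
    · intro x hx
      rcases List.mem_append.1 hx with h | h
      · exact h1 x h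
      · rw [List.mem_singleton.1 h]; exact hapos
    · rw [getD_stairRows_append]
      split_ifs with h
      · have := hmin r h
        have := hanti (Nat.zero_le r)
        omega
      · rw [h3, show r - a + a = r by omega]

/-! ### Symmetric functions are determined by their Schur coefficients -/

theorem sum_range_eq_add {N k : ℕ} (hk : k + 1 < N) (f : ℕ → ℕ) : ∑ i ∈ Finset.range N, f i =
    f k + (f (k + 1) + ∑ i ∈ ((Finset.range N).erase k).erase (k + 1), f i) := by
  rw [Finset.add_sum_erase _ f (by simp [hk]), Finset.add_sum_erase _ f (by simp; omega)]

/-- A weight which increases when contents are sorted. -/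
def sortWeight (N : ℕ) (m : ℕ → ℕ) : ℕ := ∑ i ∈ Finset.range N, (m i * m i + m i * (N - 1 - i))

theorem sum_rest_swap {N k : ℕ} (m : ℕ → ℕ) (F : ℕ → ℕ → ℕ) :
    ∑ i ∈ ((Finset.range N).erase k).erase (k + 1), F i ((m ∘ Equiv.swap k (k + 1)) i) =
      ∑ i ∈ ((Finset.range N).erase k).erase (k + 1), F i (m i) := by
  refine Finset.sum_congr rfl fun i hi => ?_
  simp only [Finset.mem_erase] at hi
  rw [Function.comp_apply, Equiv.swap_apply_of_ne_of_ne hi.2.1 hi.1]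

theorem sortWeight_swap {N k : ℕ} (hk : k + 1 < N) {m : ℕ → ℕ} (h : m k < m (k + 1)) :
    sortWeight N m < sortWeight N (m ∘ Equiv.swap k (k + 1)) := by
  rw [sortWeight, sortWeight, sum_range_eq_add hk, sum_range_eq_add hk,
    sum_rest_swap m fun i x => x * x + x * (N - 1 - i)]
  simp only [Function.comp_apply, Equiv.swap_apply_left, Equiv.swap_apply_right]
  rw [show N - 1 - k = N - 1 - (k + 1) + 1 by omega]
  generalize N - 1 - (k + 1) = e
  nlinarith

theorem equivMapDomain_swap_mem {N d k : ℕ} (hk : k + 1 < N) {m : ℕ →₀ ℕ}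
    (hm : m ∈ Finset.finsuppAntidiag (Finset.range N) d) :
    m.equivMapDomain (Equiv.swap k (k + 1)) ∈ Finset.finsuppAntidiag (Finset.range N) d := by
  have hcoe : ⇑(m.equivMapDomain (Equiv.swap k (k + 1))) = m ∘ Equiv.swap k (k + 1) := by
    funext i
    rw [Finsupp.equivMapDomain_apply, Equiv.symm_swap, Function.comp_apply]
  rw [Finset.mem_finsuppAntidiag] at hm ⊢
  rw [hcoe]
  refine ⟨?_, fun i hi => ?_⟩
  · rw [← hm.1, sum_range_eq_add hk, sum_range_eq_add hk, sum_rest_swap m fun _ x => x]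
    simp only [Function.comp_apply, Equiv.swap_apply_left, Equiv.swap_apply_right]
    omega
  · rw [Finsupp.mem_support_iff, hcoe, Function.comp_apply] at hi
    rw [Finset.mem_range]
    rcases eq_or_ne i k with rfl | h1
    · omega
    · rcases eq_or_ne i (k + 1) with rfl | h2
      · exact hk
      · rw [Equiv.swap_apply_of_ne_of_ne h1 h2] at hi
        exact Finset.mem_range.1 (hm.2 (Finsupp.mem_support_iff.2 hi))

/-- Put `x = m + δ` with `δ i = N - 1 - i`. The weight is `∑ x² - ∑ x δ`; the first sum does not
change under permutations of `x`, and the second is largest when `x` is sorted like `δ`, by the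
rearrangement inequality. -/
theorem sortWeight_le_of_perm {N : ℕ} {lam m : ℕ → ℕ} (hl : ∀ k, k + 1 < N → lam (k + 1) ≤ lam k)
    {σ : Equiv.Perm (Fin N)} (h : ∀ i, m (σ i) + (N - 1 - σ i) = lam i + (N - 1 - i)) :
    sortWeight N lam ≤ sortWeight N m := by
  have hsq : ∀ x : ℕ → ℕ, sortWeight N x + ∑ i : Fin N, (x i + (N - 1 - i)) * (N - 1 - i) =
      ∑ i : Fin N, (x i + (N - 1 - i)) * (x i + (N - 1 - i)) := by
    intro x
    rw [sortWeight, Finset.sum_range, ← Finset.sum_add_distrib]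
    exact Finset.sum_congr rfl fun i _ => by ring
  have h1 : ∑ i : Fin N, (m i + (N - 1 - i)) * (m i + (N - 1 - i)) =
      ∑ i : Fin N, (lam i + (N - 1 - i)) * (lam i + (N - 1 - i)) := by
    rw [← Equiv.sum_comp σ]
    exact Finset.sum_congr rfl fun i _ => by rw [h]
  have h2 : ∑ i : Fin N, (m i + (N - 1 - i)) * (N - 1 - i) ≤
      ∑ i : Fin N, (lam i + (N - 1 - i)) * (N - 1 - i) := by
    rw [← Equiv.sum_comp σ]
    simp only [h]
    refine Monovary.sum_mul_comp_perm_le_sum_mul (f := fun i : Fin N => lam i + (N - 1 - i))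
      (g := fun i : Fin N => N - 1 - (i : ℕ)) (σ := σ) ?_
    refine (strictAnti_shift hl).antitone.monovary fun i j hij => ?_
    exact Nat.sub_le_sub_left hij _
  have h3 := hsq m
  have h4 := hsq lam
  omega

/-- A symmetric function is determined by its coefficients at Schur functions. -/
theorem eq_zero_of_schurCoeff {N d : ℕ} {f : MvPowerSeries ℕ ℤ}
    (hsym : ∀ k, ∀ m : ℕ →₀ ℕ, f (m.equivMapDomain (Equiv.swap k (k + 1))) = f m)
    (h0 : ∀ lam : ℕ →₀ ℕ, (∀ k, lam (k + 1) ≤ lam k) → (∀ k, N ≤ k → lam k = 0) →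
      schurCoeff N d (fun i => lam i + (N - 1 - i)) f = 0) :
    ∀ m ∈ Finset.finsuppAntidiag (Finset.range N) d, f m = 0 := by
  classical
  by_contra! hne
  obtain ⟨m₀, hm₀, hf₀⟩ := hne
  obtain ⟨lam, hlam, hmax⟩ := Finset.exists_max_image
    ((Finset.finsuppAntidiag (Finset.range N) d).filter fun m => f m ≠ 0)
    (fun m => sortWeight N m) ⟨m₀, Finset.mem_filter.2 ⟨hm₀, hf₀⟩⟩
  simp only [Finset.mem_filter] at hlam hmax
  -- By symmetry of `f`, exchanging two entries in the wrong order would give a nonzero coefficient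
  -- of larger weight than the maximum.
  have hdec : ∀ m : ℕ →₀ ℕ, m ∈ Finset.finsuppAntidiag (Finset.range N) d → f m ≠ 0 →
      sortWeight N lam ≤ sortWeight N m → ∀ k, k + 1 < N → m (k + 1) ≤ m k := by
    intro m hm hf hw k hk
    by_contra! hlt
    have h1 := hmax _ ⟨equivMapDomain_swap_mem hk hm, by rwa [hsym]⟩
    have h2 := sortWeight_swap hk hlt
    have hcoe : ⇑(m.equivMapDomain (Equiv.swap k (k + 1))) = m ∘ Equiv.swap k (k + 1) := by
      funext i
      rw [Finsupp.equivMapDomain_apply, Equiv.symm_swap, Function.comp_apply]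
    rw [hcoe] at h1
    omega
  have hz : ∀ m ∈ Finset.finsuppAntidiag (Finset.range N) d, ∀ k, N ≤ k → m k = 0 := by
    intro m hm k hk
    by_contra hc
    have := (Finset.mem_finsuppAntidiag.1 hm).2 (Finsupp.mem_support_iff.2 hc)
    rw [Finset.mem_range] at this
    omega
  have hl := hdec lam hlam.1 hlam.2 le_rfl
  have h1 := h0 lam (fun k => by
    rcases lt_or_ge (k + 1) N with h | h
    · exact hl k h
    · rw [hz lam hlam.1 _ h]; exact Nat.zero_le _) (hz lam hlam.1)
  -- Any other contributing exponent has at least the weight of `lam`, hence is sorted by `hdec`,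
  -- hence equals `lam`. So the functional at `lam` returns `f lam`, which is not zero.
  rw [schurCoeff_apply, Finset.sum_eq_single_of_mem lam hlam.1, alternant_self hl fun _ _ => rfl,
    one_mul] at h1
  · exact hlam.2 h1
  · intro m hm hne
    by_contra hprod
    obtain ⟨ha, hf⟩ := mul_ne_zero_iff.1 hprod
    obtain ⟨σ, hσ⟩ := exists_perm_of_alternant_ne_zero ha
    have h2 := eq_of_alternant_ne_zero (hdec m hm hf (sortWeight_le_of_perm hl hσ)) hl ha
    apply hne
    ext k
    rcases lt_or_ge k N with h | h
    · exact h2 k h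
    · rw [hz m hm k h, hz lam hlam.1 k h]

/-! ### The criterion for sums of fat staircases -/

theorem schur_equivMapDomain_swap {D : Diagram} (hD : (D : Set (ℤ × ℤ)).OrdConnected) (k : ℕ)
    (m : ℕ →₀ ℕ) : schur D (m.equivMapDomain (Equiv.swap k (k + 1))) = schur D m := by
  rw [schur_apply, schur_apply, ← fillCount_swap hD k m]
  congr 2

theorem degree_eq_card_of_schur_ne_zero {D : Diagram} {N d : ℕ} {m : ℕ →₀ ℕ}
    (hm : m ∈ Finset.finsuppAntidiag (Finset.range N) d) (h : schur D m ≠ 0) : d = D.card := by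
  obtain ⟨T, hT⟩ : {T : D → ℕ | IsSSYT T ∧ content T = m}.Nonempty := by
    rw [Set.nonempty_iff_ne_empty]
    intro he
    rw [schur, he, Set.ncard_empty] at h
    exact h rfl
  have h1 := content_mem_finsuppAntidiag T N (lt_of_content_support (hT.2 ▸ (Finset.mem_finsuppAntidiag.1 hm).2))
  rw [hT.2] at h1
  rw [← (Finset.mem_finsuppAntidiag.1 hm).1, (Finset.mem_finsuppAntidiag.1 h1).1]

/-- The content is weakly decreasing, so all letters up to `T b` occur, each in a box of its own.
Thus `D.card` letters suffice for all Littlewood–Richardson fillings. -/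
theorem IsLR.lt_card {D : Diagram} {T : D → ℕ} (hT : IsLR T) (b : D) : T b < D.card := by
  have hanti : Antitone (content T) := antitone_nat_of_succ_le hT.content_succ_le
  have hb : 0 < content T (T b) := by
    rw [content_apply]
    exact Finset.card_pos.2 ⟨b, by simp⟩
  have hsub : Finset.range (T b + 1) ⊆ Finset.univ.image T := by
    intro k hk
    have h1 := hb.trans_le (hanti (Nat.lt_succ_iff.1 (Finset.mem_range.1 hk)))
    rw [content_apply] at h1
    obtain ⟨x, hx⟩ := Finset.card_pos.1 h1
    exact Finset.mem_image.2 ⟨x, Finset.mem_univ x, (Finset.mem_filter.1 hx).2⟩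
  have h2 := (Finset.card_le_card hsub).trans Finset.card_image_le
  rw [Finset.card_range, Finset.card_univ, Fintype.card_coe] at h2
  omega

theorem IsFatStaircase.exists_shape {E : Diagram} (hE : IsFatStaircase E) :
    ∃ (S : Diagram) (lam : ℕ → ℕ), IsShape S lam ∧ Antitone lam ∧
      (∀ k, lam k ≤ lam (k + 1) + 1) ∧ schur E = schur S := by
  obtain ⟨α, hα, t, h⟩ := hE
  have hs := (stairRows_spec α hα).2
  have hanti : Antitone fun r => (stairRows α).getD r 0 :=
    antitone_nat_of_succ_le fun r => (hs r).1
  have hS : IsShape (stair α) fun r => (stairRows α).getD r 0 := isShape_ferrers _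
  refine ⟨stair α, _, hS, hanti, fun k => (hs k).2, ?_⟩
  rcases h with rfl | rfl
  · exact schur_translate t _
  · rw [schur_translate, schur_rotate (hS.ordConnected hanti)]

theorem exists_stair {lam : ℕ →₀ ℕ} (h : ∀ k, lam (k + 1) ≤ lam k)
    (h' : ∀ k, lam k ≤ lam (k + 1) + 1) : ∃ S, IsFatStaircase S ∧ IsShape S lam := by
  have hB : ∃ B, lam B = 0 := by
    obtain ⟨B, hB⟩ := Infinite.exists_notMem_finset lam.support
    exact ⟨B, Finsupp.notMem_support_iff.1 hB⟩
  obtain ⟨α, h1, -, h3⟩ := exists_stairRows (lam 0) lam rfl hB fun r => ⟨h r, h' r⟩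
  refine ⟨stair α, ⟨α, h1, 0, Or.inl ?_⟩, ?_⟩
  · simp [translate]
  · have hS : IsShape (stair α) fun r => (stairRows α).getD r 0 := isShape_ferrers _
    simp only [h3] at hS
    exact hS

theorem IsShape.card_eq {S : Diagram} {lam : ℕ →₀ ℕ} (hS : IsShape S lam) {D : Diagram}
    {T : D → ℕ} (hT : content T = lam) : S.card = D.card := by
  have hc : content (rowFilling S) = lam := Finsupp.ext hS.content_rowFilling
  obtain ⟨N, hN⟩ : ∃ N, lam.support ⊆ Finset.range N := by
    obtain ⟨N, hN⟩ := lam.support.bddAbove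
    exact ⟨N + 1, fun i hi => Finset.mem_range.2 (Nat.lt_succ_iff.2 (hN hi))⟩
  have h1 := content_mem_finsuppAntidiag T N (lt_of_content_support (hT ▸ hN))
  have h2 := content_mem_finsuppAntidiag (rowFilling S) N (lt_of_content_support (hc ▸ hN))
  rw [hT] at h1
  rw [hc] at h2
  rw [← (Finset.mem_finsuppAntidiag.1 h1).1, (Finset.mem_finsuppAntidiag.1 h2).1]

/-- If the content of `T` had a larger drop, the Schur coefficient at this content would vanish on
every fat staircase and so on their span. On `schur D` it counts fillings, among them `T`, so it is
positive. -/
theorem content_le_of_isSum {D : Diagram} (hD : (D : Set (ℤ × ℤ)).OrdConnected)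
    (h : IsSumOfFatStaircases D) {T : D → ℕ} (hT : IsSSYT T) (hLR : IsLR T) (k : ℕ) :
    content T k ≤ content T (k + 1) + 1 := by
  classical
  by_contra! hk
  have hzero : ∀ i, D.card ≤ i → content T i = 0 := by
    intro i hi
    by_contra hc
    rw [content_apply] at hc
    obtain ⟨b, hb⟩ := Finset.card_pos.1 (Nat.pos_of_ne_zero hc)
    have := hLR.lt_card b
    rw [(Finset.mem_filter.1 hb).2] at this
    omega
  have hvanish : schurCoeff D.card D.card (fun i => content T i + (D.card - 1 - i)) (schur D) =
      0 := by
    have hle : Submodule.span ℤ {f | ∃ E, IsFatStaircase E ∧ f = schur E} ≤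
        LinearMap.ker (schurCoeff D.card D.card fun i => content T i + (D.card - 1 - i)) := by
      rw [Submodule.span_le]
      rintro _ ⟨E, hE, rfl⟩
      obtain ⟨S, lam, hS, hanti, hfat, hES⟩ := hE.exists_shape
      rw [SetLike.mem_coe, LinearMap.mem_ker, hES]
      rcases eq_or_ne D.card S.card with hc | hc
      · have h1 := schurCoeff_schur (hS.ordConnected hanti) D.card (content T)
          hLR.content_succ_le hzero
        rw [← hc] at h1
        rw [h1, Nat.cast_eq_zero, Finset.card_eq_zero, Finset.filter_eq_empty_iff]
        rintro U hU ⟨h2, h3⟩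
        rw [hS.eq_rowFilling hanti (mem_fillings.1 hU).2 h2] at h3
        have := hfat k
        rw [← hS.content_rowFilling, ← hS.content_rowFilling, h3] at this
        omega
      · rw [schurCoeff_apply]
        refine Finset.sum_eq_zero fun m hm => ?_
        by_contra hne
        exact hc (degree_eq_card_of_schur_ne_zero hm (right_ne_zero_of_mul hne))
    exact LinearMap.mem_ker.1 (hle h)
  rw [schurCoeff_schur hD _ _ hLR.content_succ_le hzero, Nat.cast_eq_zero, Finset.card_eq_zero,
    Finset.filter_eq_empty_iff] at hvanish
  exact hvanish (mem_fillings.2 ⟨hLR.lt_card, hT⟩) ⟨hLR, rfl⟩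

/-- `schur D` is the sum, over its Littlewood–Richardson fillings, of the Schur functions of their
contents, since both sides are symmetric with the same Schur coefficients. By hypothesis each
content is the shape of a fat staircase. -/
theorem isSum_of_content_le {D : Diagram} (hD : (D : Set (ℤ × ℤ)).OrdConnected)
    (h : ∀ T : D → ℕ, IsSSYT T → IsLR T → ∀ k, content T k ≤ content T (k + 1) + 1) :
    IsSumOfFatStaircases D := by
  classical
  have hex : ∀ T : D → ℕ, ∃ S, IsSSYT T → IsLR T → IsFatStaircase S ∧ IsShape S (content T) := by
    intro T
    by_cases hT : IsSSYT T ∧ IsLR T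
    · obtain ⟨S, hS⟩ := exists_stair hT.2.content_succ_le (h T hT.1 hT.2)
      exact ⟨S, fun _ _ => hS⟩
    · exact ⟨∅, fun h1 h2 => absurd ⟨h1, h2⟩ hT⟩
  choose S hS using hex
  set R := (fillings D.card D).filter IsLR with hR
  have hmem : ∀ T, T ∈ R ↔ IsSSYT T ∧ IsLR T := by
    intro T
    rw [hR, Finset.mem_filter, mem_fillings]
    exact ⟨fun h => ⟨h.1.2, h.2⟩, fun h => ⟨⟨h.2.lt_card, h.1⟩, h.2⟩⟩
  have hShape : ∀ T ∈ R, IsFatStaircase (S T) ∧ IsShape (S T) (content T) ∧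
      Antitone (content T) := fun T hT => by
    obtain ⟨h1, h2⟩ := (hmem T).1 hT
    exact ⟨(hS T h1 h2).1, (hS T h1 h2).2, antitone_nat_of_succ_le h2.content_succ_le⟩
  have happ : ∀ m : ℕ →₀ ℕ, (schur D - ∑ T ∈ R, schur (S T)) m =
      schur D m - ∑ T ∈ R, schur (S T) m := by
    intro m
    have : (∑ T ∈ R, schur (S T)) m = ∑ T ∈ R, schur (S T) m := Finset.sum_apply m R _
    rw [← this]
    rfl
  have hmain : schur D - ∑ T ∈ R, schur (S T) = 0 := by
    funext m
    obtain ⟨N, hDN, hN⟩ : ∃ N, D.card ≤ N ∧ m.support ⊆ Finset.range N := by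
      obtain ⟨N, hN⟩ := m.support.bddAbove
      exact ⟨D.card + N + 1, by omega, fun i hi => Finset.mem_range.2
        (by have := hN hi; omega)⟩
    have hm : m ∈ Finset.finsuppAntidiag (Finset.range N) (∑ i ∈ Finset.range N, m i) :=
      Finset.mem_finsuppAntidiag.2 ⟨rfl, hN⟩
    rcases eq_or_ne (∑ i ∈ Finset.range N, m i) D.card with hd | hd
    · rw [hd] at hm
      refine eq_zero_of_schurCoeff (fun k m => ?_) (fun lam h1 h2 => ?_) m hm
      · rw [happ, happ, schur_equivMapDomain_swap hD]
        congr 1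
        refine Finset.sum_congr rfl fun T hT => ?_
        obtain ⟨-, h1, h2⟩ := hShape T hT
        exact schur_equivMapDomain_swap (h1.ordConnected h2) k m
      · rw [map_sub, map_sum, schurCoeff_schur hD N lam h1 h2, sub_eq_zero]
        have hterm : ∀ T ∈ R, schurCoeff N D.card (fun i => lam i + (N - 1 - i)) (schur (S T)) =
            if content T = lam then 1 else 0 := by
          intro T hT
          obtain ⟨-, h3, h4⟩ := hShape T hT
          have h5 := schurCoeff_schur (h3.ordConnected h4) N lam h1 h2
          have hcard := h3.card_eq (T := T) rfl
          rw [hcard] at h5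
          rw [h5]
          have hc : content (rowFilling (S T)) = content T := Finsupp.ext h3.content_rowFilling
          split_ifs with h6
          · rw [Nat.cast_eq_one, Finset.card_eq_one]
            refine ⟨rowFilling (S T), Finset.eq_singleton_iff_unique_mem.2 ⟨?_, ?_⟩⟩
            · rw [Finset.mem_filter, mem_fillings]
              exact ⟨⟨fun b => ((h3.isLR_rowFilling h4).lt_card b).trans_le (hcard ▸ hDN),
                h3.isSSYT_rowFilling⟩, h3.isLR_rowFilling h4, hc.trans h6⟩
            · intro U hU
              rw [Finset.mem_filter, mem_fillings] at hU
              exact h3.eq_rowFilling h4 hU.1.2 hU.2.1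
          · rw [Nat.cast_eq_zero, Finset.card_eq_zero, Finset.filter_eq_empty_iff]
            rintro U hU ⟨h7, h8⟩
            rw [h3.eq_rowFilling h4 (mem_fillings.1 hU).2 h7, hc] at h8
            exact h6 h8
        rw [Finset.sum_congr rfl hterm, ← Finset.sum_filter, Finset.sum_const, nsmul_one]
        congr 2
        ext T
        simp only [Finset.mem_filter, mem_fillings, hmem]
        constructor
        · rintro ⟨⟨_, h3⟩, h4, h5⟩
          exact ⟨⟨h3, h4⟩, h5⟩
        · rintro ⟨⟨h3, h4⟩, h5⟩
          exact ⟨⟨fun b => (h4.lt_card b).trans_le hDN, h3⟩, h4, h5⟩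
    · rw [happ]
      have h1 : schur D m = 0 := by
        by_contra hne
        exact hd (degree_eq_card_of_schur_ne_zero hm hne)
      rw [h1, Finset.sum_eq_zero]
      · rfl
      · intro T hT
        by_contra hne
        exact hd ((degree_eq_card_of_schur_ne_zero hm hne).trans ((hShape T hT).2.1.card_eq rfl))
  rw [IsSumOfFatStaircases, sub_eq_zero.1 hmain]
  exact Submodule.sum_mem _ fun T hT => Submodule.subset_span ⟨S T, (hShape T hT).1, rfl⟩

theorem isSumOfFatStaircases_congr {D E : Diagram} (h : schur D = schur E) :
    IsSumOfFatStaircases D ↔ IsSumOfFatStaircases E := by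
  rw [IsSumOfFatStaircases, IsSumOfFatStaircases, h]

/-! ### Deleting columns at the left or right end -/

/-- The boxes above `b` in its column. -/
def boxesAbove (D : Diagram) (b : ℤ × ℤ) : Diagram := D.filter fun x => x.2 = b.2 ∧ x.1 < b.1

theorem mem_boxesAbove {D : Diagram} {b x : ℤ × ℤ} :
    x ∈ boxesAbove D b ↔ x ∈ D ∧ x.2 = b.2 ∧ x.1 < b.1 := Finset.mem_filter

section boxesAbove
variable {D : Diagram}

theorem card_boxesAbove_lt {b b' : ℤ × ℤ} (hb : b ∈ D) (h1 : b.2 = b'.2) (h2 : b.1 < b'.1) :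
    (boxesAbove D b).card < (boxesAbove D b').card := by
  refine Finset.card_lt_card (Finset.ssubset_iff_subset_ne.2 ⟨fun x hx => ?_, fun h => ?_⟩)
  · rw [mem_boxesAbove] at hx ⊢
    exact ⟨hx.1, by omega, by omega⟩
  · have : b ∈ boxesAbove D b := by rw [h, mem_boxesAbove]; exact ⟨hb, h1, h2⟩
    rw [mem_boxesAbove] at this
    omega

/-- By convexity, a box above `b` can be moved right within its row to the column of `b'` without
leaving the diagram. -/
theorem card_boxesAbove_le (hD : (D : Set (ℤ × ℤ)).OrdConnected) {b b' : ℤ × ℤ} (hb' : b' ∈ D)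
    (h1 : b.1 = b'.1) (h2 : b.2 ≤ b'.2) : (boxesAbove D b).card ≤ (boxesAbove D b').card := by
  refine Finset.card_le_card_of_injOn (fun x => (x.1, b'.2)) (fun x hx => ?_)
    fun x hx y hy h => ?_
  · rw [Finset.mem_coe, mem_boxesAbove] at hx ⊢
    exact ⟨mem_of_between hD hx.1 hb' le_rfl (by omega) (by omega) le_rfl, rfl, by
      simp only; omega⟩
  · rw [Finset.mem_coe, mem_boxesAbove] at hx hy
    exact Prod.ext (by simpa using h) (hx.2.1.trans hy.2.1.symm)

theorem exists_box_above (hD : (D : Set (ℤ × ℤ)).OrdConnected) {b : ℤ × ℤ} (hb : b ∈ D) {k : ℕ}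
    (h : (boxesAbove D b).card = k + 1) :
    (b.1 - 1, b.2) ∈ D ∧ (boxesAbove D (b.1 - 1, b.2)).card = k := by
  classical
  obtain ⟨x, hx⟩ := Finset.card_pos.1 (show 0 < (boxesAbove D b).card by omega)
  rw [mem_boxesAbove] at hx
  have hm : (b.1 - 1, b.2) ∈ D :=
    mem_of_between hD hx.1 hb (by omega) (by omega) hx.2.1.le le_rfl
  refine ⟨hm, ?_⟩
  have : boxesAbove D b = insert (b.1 - 1, b.2) (boxesAbove D (b.1 - 1, b.2)) := by
    ext y
    rw [Finset.mem_insert, mem_boxesAbove, mem_boxesAbove]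
    constructor
    · rintro ⟨h1, h2, h3⟩
      rcases (show y.1 ≤ b.1 - 1 by omega).lt_or_eq with h4 | h4
      · exact Or.inr ⟨h1, h2, h4⟩
      · exact Or.inl (Prod.ext h4 h2)
    · rintro (rfl | ⟨h1, h2, h3⟩)
      · exact ⟨hm, rfl, by simp⟩
      · simp only at h2 h3
        exact ⟨h1, h2, by omega⟩
  rw [this, Finset.card_insert_of_notMem (by simp [mem_boxesAbove])] at h
  omega

end boxesAbove

theorem ordConnected_filter {D : Diagram} (hD : (D : Set (ℤ × ℤ)).OrdConnected) {P : ℤ → Prop}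
    [DecidablePred P] (hP : ∀ x y z, P x → P y → x ≤ z → z ≤ y → P z) :
    ((D.filter fun b => P b.2 : Diagram) : Set (ℤ × ℤ)).OrdConnected := by
  refine ⟨fun x hx y hy z hz => ?_⟩
  rw [Finset.mem_coe, Finset.mem_filter] at hx hy ⊢
  exact ⟨hD.out hx.1 hy.1 hz, hP _ _ _ hx.2 hy.2 hz.1.2 hz.2.2⟩

section extend
variable {D : Diagram} {p : ℤ}

/-- Extend a filling of the columns from `p` on by filling the other columns with `0, 1, 2, …`. -/
def extendFilling (T : (D.filter fun b => p ≤ b.2 : Diagram) → ℕ) (b : D) : ℕ :=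
  if h : p ≤ b.1.2 then T ⟨b.1, Finset.mem_filter.2 ⟨b.2, h⟩⟩ else (boxesAbove D b.1).card

variable {T : (D.filter fun b => p ≤ b.2 : Diagram) → ℕ}

theorem extendFilling_of_le {b : D} (h : p ≤ b.1.2) :
    extendFilling T b = T ⟨b.1, Finset.mem_filter.2 ⟨b.2, h⟩⟩ := dif_pos h

theorem extendFilling_of_lt {b : D} (h : b.1.2 < p) :
    extendFilling T b = (boxesAbove D b.1).card := dif_neg (not_le.2 h)

/-- In the columns kept, the boxes above `b` contain distinct letters smaller than that of `b`. This
makes the rows weakly increasing across the border at column `p`. -/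
theorem card_boxesAbove_le_extendFilling (hT : IsSSYT T) (b : D) :
    (boxesAbove D b.1).card ≤ extendFilling T b := by
  classical
  rcases lt_or_ge b.1.2 p with h | h
  · rw [extendFilling_of_lt h]
  · have hmem : ∀ x ∈ boxesAbove D b.1, x ∈ D.filter fun b => p ≤ b.2 := by
      intro x hx
      rw [mem_boxesAbove] at hx
      exact Finset.mem_filter.2 ⟨hx.1, by omega⟩
    rw [← Finset.card_range (extendFilling T b), extendFilling_of_le h]
    refine Finset.card_le_card_of_injOn
      (fun x => if hx : x ∈ D.filter fun b => p ≤ b.2 then T ⟨x, hx⟩ else 0)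
      (fun x hx => ?_) fun x hx y hy hxy => ?_
    · simp only
      rw [dif_pos (hmem x hx), Finset.mem_coe, Finset.mem_range]
      rw [Finset.mem_coe, mem_boxesAbove] at hx
      exact hT.2 _ _ hx.2.1 hx.2.2
    · simp only at hxy
      rw [dif_pos (hmem x hx), dif_pos (hmem y hy)] at hxy
      rw [Finset.mem_coe, mem_boxesAbove] at hx hy
      have hc : x.2 = y.2 := hx.2.1.trans hy.2.1.symm
      rcases lt_trichotomy x.1 y.1 with h1 | h1 | h1
      · exact absurd hxy (hT.2 ⟨x, _⟩ ⟨y, _⟩ hc h1).ne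
      · exact Prod.ext h1 hc
      · exact absurd hxy (hT.2 ⟨y, _⟩ ⟨x, _⟩ hc.symm h1).ne'

theorem isSSYT_extendFilling (hD : (D : Set (ℤ × ℤ)).OrdConnected) (hT : IsSSYT T) :
    IsSSYT (extendFilling T) := by
  refine ⟨fun b b' h1 h2 => ?_, fun b b' h1 h2 => ?_⟩
  · rcases lt_or_ge b.1.2 p with h | h
    · rw [extendFilling_of_lt h]
      exact (card_boxesAbove_le hD b'.2 h1 h2.le).trans (card_boxesAbove_le_extendFilling hT b')
    · rw [extendFilling_of_le h, extendFilling_of_le (h.trans h2.le)]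
      exact hT.1 _ _ h1 h2
  · rcases lt_or_ge b.1.2 p with h | h
    · rw [extendFilling_of_lt h, extendFilling_of_lt (h1 ▸ h)]
      exact card_boxesAbove_lt b.2 h1 h2
    · rw [extendFilling_of_le h, extendFilling_of_le (h1 ▸ h)]
      exact hT.2 _ _ h1 h2

theorem countRight_extendFilling (j : ℤ) (k : ℕ) : countRight (extendFilling T) j k =
    countRight T j k + (Finset.univ.filter fun b : D =>
      (j ≤ b.1.2 ∧ b.1.2 < p) ∧ extendFilling T b = k).card := by
  classical
  rw [countRight, ← Finset.card_filter_add_card_filter_not (fun b : D => p ≤ b.1.2),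
    Finset.filter_filter, Finset.filter_filter]
  congr 1
  · refine Finset.card_bij' (fun b hb => ⟨b.1, Finset.mem_filter.2 ⟨b.2,
      (Finset.mem_filter.1 hb).2.2⟩⟩) (fun b _ => ⟨b.1, (Finset.mem_filter.1 b.2).1⟩) ?_ ?_
      (fun _ _ => rfl) (fun _ _ => rfl)
    · intro b hb
      have h := (Finset.mem_filter.1 hb).2
      rw [extendFilling_of_le h.2] at h
      exact Finset.mem_filter.2 ⟨Finset.mem_univ _, h.1⟩
    · intro b hb
      have h := (Finset.mem_filter.1 hb).2
      have hp := (Finset.mem_filter.1 b.2).2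
      refine Finset.mem_filter.2 ⟨Finset.mem_univ _, ⟨h.1, ?_⟩, hp⟩
      exact (extendFilling_of_le (T := T) (b := ⟨b.1, (Finset.mem_filter.1 b.2).1⟩) hp).trans h.2
  · congr 1
    ext b
    simp only [Finset.mem_filter, Finset.mem_univ, true_and, not_le]
    tauto

/-- In an added column each `k + 1` has a `k` directly above it. This serves twice: it preserves the
Littlewood–Richardson condition, and it shows that the added columns cannot reduce a drop in the
content. -/
theorem card_left_extendFilling_succ_le (hD : (D : Set (ℤ × ℤ)).OrdConnected) (j : ℤ) (k : ℕ) :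
    (Finset.univ.filter fun b : D => (j ≤ b.1.2 ∧ b.1.2 < p) ∧ extendFilling T b = k + 1).card ≤
      (Finset.univ.filter fun b : D => (j ≤ b.1.2 ∧ b.1.2 < p) ∧ extendFilling T b = k).card := by
  refine card_filter_le_of_above (P := fun c => j ≤ c ∧ c < p) fun b hP hb => ?_
  rw [extendFilling_of_lt hP.2] at hb
  obtain ⟨h1, h2⟩ := exists_box_above hD b.2 hb
  refine ⟨⟨_, h1⟩, rfl, ?_⟩
  exact (extendFilling_of_lt (b := ⟨_, h1⟩) hP.2).trans h2

theorem isLR_extendFilling (hD : (D : Set (ℤ × ℤ)).OrdConnected) (hT : IsLR T) :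
    IsLR (extendFilling T) := by
  intro j k
  rw [countRight_extendFilling, countRight_extendFilling]
  exact add_le_add (hT j k) (card_left_extendFilling_succ_le hD j k)

end extend

theorem content_eq_countRight {D : Diagram} {j : ℤ} (h : ∀ b ∈ D, j ≤ b.2) (T : D → ℕ) (k : ℕ) :
    content T k = countRight T j k := by
  rw [content_apply, countRight]
  congr 1
  ext b
  simp only [Finset.mem_filter, Finset.mem_univ, true_and]
  exact ⟨fun hb => ⟨h b.1 b.2, hb⟩, fun hb => hb.2⟩

/-- Removing the columns left of column `p` preserves sums of fat staircases. -/
theorem IsSumOfFatStaircases.filter_ge {D : Diagram} (hD : (D : Set (ℤ × ℤ)).OrdConnected)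
    (h : IsSumOfFatStaircases D) (p : ℤ) :
    IsSumOfFatStaircases (D.filter fun b => p ≤ b.2) := by
  refine isSum_of_content_le (ordConnected_filter hD (P := fun c => p ≤ c)
    fun x y z hx _ hxz _ => hx.trans hxz) fun T hT hLR k => ?_
  obtain ⟨q, hq⟩ : ∃ q : ℤ × ℤ, ∀ b ∈ D, q ≤ b := D.bddBelow
  have h1 := content_le_of_isSum hD h (isSSYT_extendFilling hD hT) (isLR_extendFilling hD hLR) k
  rw [content_eq_countRight (j := q.2) fun b hb => (hq b hb).2,
    content_eq_countRight (j := q.2) fun b hb => (hq b hb).2,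
    countRight_extendFilling, countRight_extendFilling] at h1
  rw [content_eq_countRight (j := q.2) fun b hb => (hq b (Finset.mem_filter.1 hb).1).2,
    content_eq_countRight (j := q.2) fun b hb => (hq b (Finset.mem_filter.1 hb).1).2]
  have h2 := card_left_extendFilling_succ_le (T := T) hD q.2 k
  omega

theorem mem_rotate {D : Diagram} {b : ℤ × ℤ} : b ∈ rotate D ↔ -b ∈ D := by
  rw [rotate, Finset.mem_image]
  constructor
  · rintro ⟨x, hx, rfl⟩
    rwa [neg_neg]
  · exact fun h => ⟨-b, h, neg_neg b⟩

theorem mem_translate {D : Diagram} {t b : ℤ × ℤ} : b ∈ translate t D ↔ b - t ∈ D := by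
  rw [translate, Finset.mem_image]
  constructor
  · rintro ⟨x, hx, rfl⟩
    rwa [add_sub_cancel_right]
  · exact fun h => ⟨b - t, h, sub_add_cancel b t⟩

theorem ordConnected_rotate {D : Diagram} (hD : (D : Set (ℤ × ℤ)).OrdConnected) :
    ((rotate D : Diagram) : Set (ℤ × ℤ)).OrdConnected := by
  refine ⟨fun x hx y hy z hz => ?_⟩
  rw [Finset.mem_coe, mem_rotate] at hx hy ⊢
  exact hD.out hy hx ⟨neg_le_neg hz.2, neg_le_neg hz.1⟩

theorem ordConnected_translate {D : Diagram} (hD : (D : Set (ℤ × ℤ)).OrdConnected) (t : ℤ × ℤ) :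
    ((translate t D : Diagram) : Set (ℤ × ℤ)).OrdConnected := by
  refine ⟨fun x hx y hy z hz => ?_⟩
  rw [Finset.mem_coe, mem_translate] at hx hy ⊢
  exact hD.out hx hy ⟨sub_le_sub_right hz.1 t, sub_le_sub_right hz.2 t⟩

/-- Removing the columns right of column `q` preserves sums of fat staircases. -/
theorem IsSumOfFatStaircases.filter_le {D : Diagram} (hD : (D : Set (ℤ × ℤ)).OrdConnected)
    (h : IsSumOfFatStaircases D) (q : ℤ) :
    IsSumOfFatStaircases (D.filter fun b => b.2 ≤ q) := by
  have h1 := ((isSumOfFatStaircases_congr (schur_rotate hD)).2 h).filter_ge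
    (ordConnected_rotate hD) (-q)
  have h2 : (rotate D).filter (fun b => -q ≤ b.2) = rotate (D.filter fun b => b.2 ≤ q) := by
    ext b
    rw [Finset.mem_filter, mem_rotate, mem_rotate, Finset.mem_filter, Prod.snd_neg]
    exact and_congr_right fun _ => by omega
  rw [h2] at h1
  exact (isSumOfFatStaircases_congr (schur_rotate (ordConnected_filter hD (P := fun c => c ≤ q)
    fun x y z _ hy _ hzy => hzy.trans hy))).1 h1

/-! ### Near-concatenation of skew diagrams -/

theorem unbotD_max_mem {s : Finset ℤ} (h : s.Nonempty) :
    s.max.unbotD 0 ∈ s ∧ ∀ x ∈ s, x ≤ s.max.unbotD 0 := by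
  rw [← Finset.coe_max' h, WithBot.unbotD_coe]
  exact ⟨s.max'_mem h, fun x hx => s.le_max' x hx⟩

theorem untopD_min_mem {s : Finset ℤ} (h : s.Nonempty) :
    s.min.untopD 0 ∈ s ∧ ∀ x ∈ s, s.min.untopD 0 ≤ x := by
  rw [← Finset.coe_min' h, WithTop.untopD_coe]
  exact ⟨s.min'_mem h, fun x hx => s.min'_le x hx⟩

theorem mem_col {D : Diagram} {j : ℤ} {b : ℤ × ℤ} : b ∈ col D j ↔ b ∈ D ∧ b.2 = j :=
  Finset.mem_filter

section corners
variable {D : Diagram}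

theorem lastCol_spec (hD : D.Nonempty) :
    (col D (lastCol D)).Nonempty ∧ ∀ b ∈ D, b.2 ≤ lastCol D := by
  obtain ⟨h1, h2⟩ := unbotD_max_mem (hD.image Prod.snd)
  obtain ⟨b, hb, h⟩ := Finset.mem_image.1 h1
  exact ⟨⟨b, mem_col.2 ⟨hb, h⟩⟩, fun b hb => h2 _ (Finset.mem_image_of_mem _ hb)⟩

theorem firstCol_spec (hD : D.Nonempty) :
    (col D (firstCol D)).Nonempty ∧ ∀ b ∈ D, firstCol D ≤ b.2 := by
  obtain ⟨h1, h2⟩ := untopD_min_mem (hD.image Prod.snd)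
  obtain ⟨b, hb, h⟩ := Finset.mem_image.1 h1
  exact ⟨⟨b, mem_col.2 ⟨hb, h⟩⟩, fun b hb => h2 _ (Finset.mem_image_of_mem _ hb)⟩

theorem topRight_spec (hD : D.Nonempty) :
    topRight D ∈ D ∧ ∀ b ∈ D, b.2 = lastCol D → (topRight D).1 ≤ b.1 := by
  obtain ⟨h1, h2⟩ := untopD_min_mem ((lastCol_spec hD).1.image Prod.fst)
  obtain ⟨b, hb, h⟩ := Finset.mem_image.1 h1
  rw [mem_col] at hb
  refine ⟨?_, fun x hx hxc => h2 _ (Finset.mem_image_of_mem _ (mem_col.2 ⟨hx, hxc⟩))⟩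
  have : topRight D = b := Prod.ext h.symm hb.2.symm
  rw [this]
  exact hb.1

theorem bottomLeft_spec (hD : D.Nonempty) :
    bottomLeft D ∈ D ∧ ∀ b ∈ D, b.2 = firstCol D → b.1 ≤ (bottomLeft D).1 := by
  obtain ⟨h1, h2⟩ := unbotD_max_mem ((firstCol_spec hD).1.image Prod.fst)
  obtain ⟨b, hb, h⟩ := Finset.mem_image.1 h1
  rw [mem_col] at hb
  refine ⟨?_, fun x hx hxc => h2 _ (Finset.mem_image_of_mem _ (mem_col.2 ⟨hx, hxc⟩))⟩
  have : bottomLeft D = b := Prod.ext h.symm hb.2.symm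
  rw [this]
  exact hb.1

/-- A box higher than the top-right corner would, by convexity, force a box above that corner in the
last column. -/
theorem topRight_le (hD : (D : Set (ℤ × ℤ)).OrdConnected) {b : ℤ × ℤ} (hb : b ∈ D) :
    (topRight D).1 ≤ b.1 := by
  obtain ⟨h1, h2⟩ := topRight_spec ⟨b, hb⟩
  by_contra! h
  have := h2 _ (mem_of_between hD hb h1 le_rfl h.le ((lastCol_spec ⟨b, hb⟩).2 b hb) le_rfl) rfl
  simp only at this
  omega

theorem le_bottomLeft (hD : (D : Set (ℤ × ℤ)).OrdConnected) {b : ℤ × ℤ} (hb : b ∈ D) :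
    b.1 ≤ (bottomLeft D).1 := by
  obtain ⟨h1, h2⟩ := bottomLeft_spec ⟨b, hb⟩
  by_contra! h
  have := h2 _ (mem_of_between hD h1 hb h.le le_rfl le_rfl ((firstCol_spec ⟨b, hb⟩).2 b hb)) rfl
  simp only at this
  omega

theorem mem_lastCol (hD : (D : Set (ℤ × ℤ)).OrdConnected) (hne : D.Nonempty) {r : ℤ}
    (h1 : (topRight D).1 ≤ r) (h2 : r < (topRight D).1 + (col D (lastCol D)).card) :
    (r, lastCol D) ∈ D := by
  obtain ⟨ht, hmin⟩ := topRight_spec hne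
  by_contra hr
  have hsub : (col D (lastCol D)).image Prod.fst ⊆ Finset.Ico (topRight D).1 r := by
    intro x hx
    obtain ⟨b, hb, rfl⟩ := Finset.mem_image.1 hx
    rw [mem_col] at hb
    rw [Finset.mem_Ico]
    refine ⟨hmin b hb.1 hb.2, ?_⟩
    by_contra! hbr
    exact hr (mem_of_between hD ht hb.1 h1 hbr le_rfl hb.2.ge)
  have hcard := Finset.card_le_card hsub
  rw [Finset.card_image_of_injOn, Int.card_Ico] at hcard
  · omega
  · intro b hb b' hb' h
    rw [Finset.mem_coe, mem_col] at hb hb'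
    exact Prod.ext h (hb.2.trans hb'.2.symm)

theorem mem_firstCol (hD : (D : Set (ℤ × ℤ)).OrdConnected) (hne : D.Nonempty) {r : ℤ}
    (h1 : r ≤ (bottomLeft D).1) (h2 : (bottomLeft D).1 < r + (col D (firstCol D)).card) :
    (r, firstCol D) ∈ D := by
  obtain ⟨ht, hmax⟩ := bottomLeft_spec hne
  by_contra hr
  have hsub : (col D (firstCol D)).image Prod.fst ⊆ Finset.Ioc r (bottomLeft D).1 := by
    intro x hx
    obtain ⟨b, hb, rfl⟩ := Finset.mem_image.1 hx
    rw [mem_col] at hb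
    rw [Finset.mem_Ioc]
    refine ⟨?_, hmax b hb.1 hb.2⟩
    by_contra! hbr
    exact hr (mem_of_between hD hb.1 ht hbr h1 hb.2.le le_rfl)
  have hcard := Finset.card_le_card hsub
  rw [Finset.card_image_of_injOn, Int.card_Ioc] at hcard
  · omega
  · intro b hb b' hb' h
    rw [Finset.mem_coe, mem_col] at hb hb'
    exact Prod.ext h (hb.2.trans hb'.2.symm)

end corners

section nearConcat
variable {D₁ D₂ : Diagram} {i : ℕ}

theorem lt_col_of_mem_translate (h2 : D₂.Nonempty) {b : ℤ × ℤ}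
    (hb : b ∈ translate (topRight D₁ + ((i : ℤ) - 1, 1) - bottomLeft D₂) D₂) :
    lastCol D₁ < b.2 := by
  rw [mem_translate] at hb
  have := (firstCol_spec h2).2 _ hb
  simp only [Prod.snd_sub, Prod.snd_add, topRight, bottomLeft] at this
  omega

theorem filter_nearConcat_left (h1 : D₁.Nonempty) (h2 : D₂.Nonempty) :
    (nearConcat i D₁ D₂).filter (fun b => b.2 ≤ lastCol D₁) = D₁ := by
  ext b
  rw [Finset.mem_filter, nearConcat, Finset.mem_union]
  constructor
  · rintro ⟨h | h, hb⟩
    · exact h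
    · exact absurd (lt_col_of_mem_translate h2 h) (not_lt.2 hb)
  · exact fun h => ⟨Or.inl h, (lastCol_spec h1).2 b h⟩

theorem filter_nearConcat_right (h1 : D₁.Nonempty) (h2 : D₂.Nonempty) :
    (nearConcat i D₁ D₂).filter (fun b => lastCol D₁ + 1 ≤ b.2) =
      translate (topRight D₁ + ((i : ℤ) - 1, 1) - bottomLeft D₂) D₂ := by
  ext b
  rw [Finset.mem_filter, nearConcat, Finset.mem_union]
  constructor
  · rintro ⟨h | h, hb⟩
    · exact absurd ((lastCol_spec h1).2 b h) (by omega)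
    · exact h
  · exact fun h => ⟨Or.inr h, lt_col_of_mem_translate h2 h⟩

/-- Only an interval from `D₁` to `D₂` needs thought. Its rows lie among the `i` rows shared by the
last column of `D₁` and the first column of `D₂`, both of which have at least `i` boxes and so
contain these rows entirely. -/
theorem ordConnected_nearConcat (hD₁ : (D₁ : Set (ℤ × ℤ)).OrdConnected)
    (hD₂ : (D₂ : Set (ℤ × ℤ)).OrdConnected) (h : CanNearConcat i D₁ D₂) :
    ((nearConcat i D₁ D₂ : Diagram) : Set (ℤ × ℤ)).OrdConnected := by
  obtain ⟨hne₁, hne₂, hi₁, hi₂⟩ := h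
  refine ⟨fun x hx y hy z hz => ?_⟩
  have hz1 := hz.1.1
  have hz2 := hz.1.2
  have hz3 := hz.2.1
  have hz4 := hz.2.2
  rw [Finset.mem_coe, nearConcat, Finset.mem_union] at hx hy ⊢
  rcases hx with hx | hx <;> rcases hy with hy | hy
  · exact Or.inl (hD₁.out hx hy hz)
  · have hx1 := topRight_le hD₁ hx
    have hy1 := le_bottomLeft hD₂ (mem_translate.1 hy)
    simp only [Prod.fst_sub, Prod.fst_add] at hy1
    rcases le_or_gt z.2 (lastCol D₁) with hc | hc
    · left
      have hm := mem_lastCol hD₁ hne₁ (r := z.1) (by omega) (by omega)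
      exact mem_of_between hD₁ hx hm hz1 le_rfl hz2 hc
    · right
      rw [mem_translate] at hy ⊢
      have hm := mem_firstCol hD₂ hne₂
        (r := (z - (topRight D₁ + ((i : ℤ) - 1, 1) - bottomLeft D₂)).1)
        (by simp only [Prod.fst_sub, Prod.fst_add]; omega)
        (by simp only [Prod.fst_sub, Prod.fst_add]; omega)
      refine mem_of_between hD₂ hm hy le_rfl ?_ ?_ ?_
      · simp only [Prod.fst_sub, Prod.fst_add]; omega
      · simp only [Prod.snd_sub, Prod.snd_add, topRight, bottomLeft]; omega
      · simp only [Prod.snd_sub, Prod.snd_add]; omega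
  · have := lt_col_of_mem_translate hne₂ hx
    have := (lastCol_spec hne₁).2 y hy
    omega
  · exact Or.inr ((ordConnected_translate hD₂ _).out hx hy hz)

theorem IsSumOfFatStaircases.of_nearConcat_left (hD₁ : (D₁ : Set (ℤ × ℤ)).OrdConnected)
    (hD₂ : (D₂ : Set (ℤ × ℤ)).OrdConnected) (h : CanNearConcat i D₁ D₂)
    (hs : IsSumOfFatStaircases (nearConcat i D₁ D₂)) : IsSumOfFatStaircases D₁ := by
  have := hs.filter_le (ordConnected_nearConcat hD₁ hD₂ h) (lastCol D₁)
  rwa [filter_nearConcat_left h.1 h.2.1] at this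

theorem IsSumOfFatStaircases.of_nearConcat_right (hD₁ : (D₁ : Set (ℤ × ℤ)).OrdConnected)
    (hD₂ : (D₂ : Set (ℤ × ℤ)).OrdConnected) (h : CanNearConcat i D₁ D₂)
    (hs : IsSumOfFatStaircases (nearConcat i D₁ D₂)) : IsSumOfFatStaircases D₂ := by
  have := hs.filter_ge (ordConnected_nearConcat hD₁ hD₂ h) (lastCol D₁ + 1)
  rw [filter_nearConcat_right h.1 h.2.1] at this
  exact (isSumOfFatStaircases_congr (schur_translate _ D₂)).1 this

end nearConcat

/-! ### Adding and removing columns -/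

theorem ordConnected_column (n : ℕ) : ((column n : Diagram) : Set (ℤ × ℤ)).OrdConnected := by
  refine ⟨fun x hx y hy z hz => ?_⟩
  simp only [column, Finset.mem_coe, Finset.mem_image, Finset.mem_range] at hx hy ⊢
  obtain ⟨a, ha, rfl⟩ := hx
  obtain ⟨c, hc, rfl⟩ := hy
  obtain ⟨⟨h1, h2⟩, h3, h4⟩ := hz
  simp only at h1 h2 h3 h4
  exact ⟨z.1.toNat, by omega, Prod.ext (by simp only; omega) (by simp only; omega)⟩

theorem isSumOfFatStaircases_empty : IsSumOfFatStaircases ∅ :=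
  Submodule.subset_span ⟨∅, ⟨[], by simp, 0, Or.inl (by simp [stair, ferrers, translate])⟩, rfl⟩

theorem exists_mem_col_of_path {D : Diagram} {x y : ℤ × ℤ} (hx : x ∈ D)
    (h : Relation.ReflTransGen (fun x y => x ∈ D ∧ y ∈ D ∧ Adjacent x y) x y) :
    ∀ c, x.2 ≤ c → c ≤ y.2 → ∃ z ∈ D, z.2 = c := by
  induction h with
  | refl => exact fun c h1 h2 => ⟨x, hx, le_antisymm h1 h2⟩
  | @tail y z _ hyz ih =>
    intro c h1 h2
    rcases le_or_gt c y.2 with h | h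
    · exact ih c h1 h
    · refine ⟨z, hyz.2.1, ?_⟩
      have h3 := hyz.2.2
      rw [Adjacent] at h3
      have h4 := abs_nonneg (y.1 - z.1)
      have h5 := neg_abs_le (y.2 - z.2)
      omega

/-- A path from the first to the last remaining column meets every column between, so none of these
was removed: only columns at the two ends are missing. -/
theorem IsSumOfFatStaircases.removeColumns {D : Diagram} {R : Finset ℤ}
    (hD : (D : Set (ℤ × ℤ)).OrdConnected) (h : IsSumOfFatStaircases D)
    (hc : IsConnectedDiagram (removeColumns D R)) :
    IsSumOfFatStaircases (FatStair.removeColumns D R) := by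
  rcases (FatStair.removeColumns D R).eq_empty_or_nonempty with he | hne
  · rw [he]
    exact isSumOfFatStaircases_empty
  obtain ⟨⟨x, hx⟩, hfirst⟩ := firstCol_spec hne
  obtain ⟨⟨y, hy⟩, hlast⟩ := lastCol_spec hne
  rw [mem_col] at hx hy
  have heq : FatStair.removeColumns D R = (D.filter fun b => firstCol (FatStair.removeColumns D R) ≤
      b.2).filter fun b => b.2 ≤ lastCol (FatStair.removeColumns D R) := by
    ext b
    rw [Finset.mem_filter, Finset.mem_filter]
    constructor
    · exact fun hb => ⟨⟨(Finset.mem_filter.1 hb).1, hfirst b hb⟩, hlast b hb⟩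
    · rintro ⟨⟨hb, h1⟩, h2⟩
      obtain ⟨z, hz, hzb⟩ := exists_mem_col_of_path hx.1 (hc x hx.1 y hy.1) b.2
        (hx.2.le.trans h1) (h2.trans hy.2.ge)
      exact Finset.mem_filter.2 ⟨hb, hzb ▸ (Finset.mem_filter.1 hz).2⟩
  rw [heq]
  exact (h.filter_ge hD _).filter_le (ordConnected_filter hD
    (P := fun c => firstCol (FatStair.removeColumns D R) ≤ c)
    fun _ _ _ hx _ hxz _ => hx.trans hxz) _

theorem AddsColumn.of_isSum {D E : Diagram} (hD : (D : Set (ℤ × ℤ)).OrdConnected)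
    (h : AddsColumn D E) : (E : Set (ℤ × ℤ)).OrdConnected ∧
      (IsSumOfFatStaircases E → IsSumOfFatStaircases D) := by
  obtain ⟨n, i, ⟨h, rfl⟩ | ⟨h, rfl⟩⟩ := h
  · exact ⟨ordConnected_nearConcat hD (ordConnected_column n) h,
      IsSumOfFatStaircases.of_nearConcat_left hD (ordConnected_column n) h⟩
  · exact ⟨ordConnected_nearConcat (ordConnected_column n) hD h,
      IsSumOfFatStaircases.of_nearConcat_right (ordConnected_column n) hD h⟩

theorem of_isSum_of_reflTransGen {D E : Diagram} (hD : (D : Set (ℤ × ℤ)).OrdConnected)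
    (h : Relation.ReflTransGen AddsColumn D E) : (E : Set (ℤ × ℤ)).OrdConnected ∧
      (IsSumOfFatStaircases E → IsSumOfFatStaircases D) := by
  induction h with
  | refl => exact ⟨hD, id⟩
  | tail _ h ih =>
    obtain ⟨h1, h2⟩ := h.of_isSum ih.1
    exact ⟨h1, fun h => ih.2 (h2 h)⟩

end FatStair

open FatStair

theorem lemma4p1 :
    -- adding a single column on the right or on the left
    (∀ D : Diagram, IsSkewDiagram D → ¬ IsSumOfFatStaircases D → ∀ n i : ℕ,
      (CanNearConcat i D (column n) → ¬ IsSumOfFatStaircases (nearConcat i D (column n))) ∧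
      (CanNearConcat i (column n) D → ¬ IsSumOfFatStaircases (nearConcat i (column n) D))) ∧
    -- adding any number of columns
    (∀ D D' : Diagram, IsSkewDiagram D → ¬ IsSumOfFatStaircases D →
      Relation.ReflTransGen AddsColumn D D' → ¬ IsSumOfFatStaircases D') ∧
    -- removing columns so that the remaining diagram is connected
    (∀ (D : Diagram) (R : Finset ℤ), IsSkewDiagram D → IsSumOfFatStaircases D →
      IsConnectedDiagram (removeColumns D R) → IsSumOfFatStaircases (removeColumns D R)) := by
  refine ⟨fun D hD hs n i => ⟨fun h hc => ?_, fun h hc => ?_⟩, fun D D' hD hs h hc => ?_,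
    fun D R hD hs hc => ?_⟩ <;> rw [isSkewDiagram_iff] at hD
  · exact hs (hc.of_nearConcat_left hD (ordConnected_column n) h)
  · exact hs (hc.of_nearConcat_right (ordConnected_column n) hD h)
  · exact hs ((of_isSum_of_reflTransGen hD h).2 hc)
  · exact hs.removeColumns hD hc
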